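/- **Theorem 2.** Let $1\le p<\infty$, let $D,D'\subset\mathbb R^n$ be domains (nonempty connected open sets), and let $\varphi:D\to D'$ be a homeomorphism of $D$ onto $D'$ that belongs to $L^1_p(D)$. Then there is a set function $\Phi$, defined and nonnegative on the open bounded subsets of $D'$, with the following properties. 1. $\Phi$ is bounded: there is a constant $C<\infty$ with $\Phi(A')\le C$ for every open bounded $A'\subset D'$. 2. $\Phi$ is monotone: $\Phi(A_1')\le\Phi(A_2')$ for open bounded sets $A_1'\subset A_2'\subset D'$. 3. $\Phi$ is countably additive: $\Phi\bigl(\bigcup_i A_i'\bigr)=\sum_i\Phi(A_i')$ for every countable family of pairwise disjoint open sets $A_i'\subset D'$ whose union is bounded. 4. For every open bounded set $A'\subset D'$ and every $f\in\overset{\circ}{L}{}^1_\infty(A')$ the composition $f\circ\varphi$ belongs to $L^1_p(\varphi^{-1}(A'))$ and $$\int_{\varphi^{-1}(A')}|\nabla(f\circ\varphi)|^p\,dx\;\le\;\Phi(A')\cdot\operatorname*{ess\,sup}_{y\in A'}|\nabla f(y)|^p .$$ Here, for an open set $U\subset\mathbb R^n$, $\nabla$ denotes the weak gradient and $|\cdot|$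 the Euclidean norm. $L^1_p(U)$, $1\le p<\infty$, is the space of locally summable, weakly differentiable functions $f:U\to\mathbb R$ with $\int_U|\nabla f|^p\,dx<\infty$. A mapping belongs to $L^1_p(U)$ if all its coordinate functions do. $L^1_\infty(U)$ is the space of locally summable, weakly differentiable functions $f:U\to\mathbb R$ for which the seminorm $$\|f\mid L^1_\infty(U)\|=\sup_{x\in U}\ \limsup_{y\to x,\ y\in U}\frac{|f(x)-f(y)|}{|x-y|}$$ is finite (such functions are continuous). $\overset{\circ}{L}{}^1_\infty(U)$ is the closure, in this seminorm, of $C_0^\infty(U)$ in $L^1_\infty(U)$. -/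

import Mathlib

open MeasureTheory Set Filter Topology
open scoped ENNReal NNReal ContDiff

/-- `η` belongs to `C₀^∞(U)`: it is infinitely smooth and its support is a compact subset of `U`. -/
def IsTestFunction {n : ℕ} (U : Set (EuclideanSpace ℝ (Fin n)))
    (η : EuclideanSpace ℝ (Fin n) → ℝ) : Prop :=
  ContDiff ℝ ∞ η ∧ HasCompactSupport η ∧ tsupport η ⊆ U

/-- `f` is locally summable on `U` and weakly differentiable there with (locally summable)
weak gradient `G`. -/
structure HasWeakGradient {n : ℕ} (U : Set (EuclideanSpace ℝ (Fin n)))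
    (f : EuclideanSpace ℝ (Fin n) → ℝ)
    (G : EuclideanSpace ℝ (Fin n) → EuclideanSpace ℝ (Fin n)) : Prop where
  locallyIntegrableOn : LocallyIntegrableOn f U volume
  locallyIntegrableOn_grad : LocallyIntegrableOn G U volume
  integral_eq : ∀ η : EuclideanSpace ℝ (Fin n) → ℝ, IsTestFunction U η → ∀ i : Fin n,
    ∫ x in U, f x * fderiv ℝ η x (EuclideanSpace.single i 1) = - ∫ x in U, G x i * η x

/-- The class `L¹_p(U)`, `p < ∞`: locally summable, weakly differentiable functions on `U` whose
weak gradient belongs to `L_p(U)`. -/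
def MemL1 {n : ℕ} (p : ℝ) (U : Set (EuclideanSpace ℝ (Fin n)))
    (f : EuclideanSpace ℝ (Fin n) → ℝ) : Prop :=
  ∃ G : EuclideanSpace ℝ (Fin n) → EuclideanSpace ℝ (Fin n),
    HasWeakGradient U f G ∧ MemLp G (ENNReal.ofReal p) (volume.restrict U)

/-- A mapping belongs to `L¹_p(U)` if all its coordinate functions do. -/
def MapMemL1 {n : ℕ} (p : ℝ) (U : Set (EuclideanSpace ℝ (Fin n)))
    (φ : EuclideanSpace ℝ (Fin n) → EuclideanSpace ℝ (Fin n)) : Prop :=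
  ∀ j : Fin n, MemL1 p U (fun x => φ x j)

/-- The seminorm of `L¹_∞(U)`:
`sup_{x ∈ U} limsup_{y → x, y ≠ x, y ∈ U} |f x - f y| / |x - y|`. -/
noncomputable def lipSeminorm {n : ℕ} (U : Set (EuclideanSpace ℝ (Fin n)))
    (f : EuclideanSpace ℝ (Fin n) → ℝ) : ℝ≥0∞ :=
  ⨆ x ∈ U, limsup (fun y => edist (f x) (f y) / edist x y) (𝓝[U \ {x}] x)

/-- The class `L¹_∞(U)`: locally summable, weakly differentiable functions with finite seminorm. -/
def MemL1Infty {n : ℕ} (U : Set (EuclideanSpace ℝ (Fin n)))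
    (f : EuclideanSpace ℝ (Fin n) → ℝ) : Prop :=
  (∃ G : EuclideanSpace ℝ (Fin n) → EuclideanSpace ℝ (Fin n), HasWeakGradient U f G) ∧
    lipSeminorm U f < ⊤

/-- The class `L̊¹_∞(U)`: the closure of `C₀^∞(U)` in `L¹_∞(U)`. -/
def MemL1InftyZero {n : ℕ} (U : Set (EuclideanSpace ℝ (Fin n)))
    (f : EuclideanSpace ℝ (Fin n) → ℝ) : Prop :=
  MemL1Infty U f ∧ ∀ ε : ℝ≥0∞, 0 < ε →
    ∃ g : EuclideanSpace ℝ (Fin n) → ℝ, IsTestFunction U g ∧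
      lipSeminorm U (fun x => f x - g x) < ε

/-- The nonnegative set function `Φ`, considered on the open bounded subsets of `V`, is bounded. -/
def IsBoundedSetFunction {n : ℕ} (V : Set (EuclideanSpace ℝ (Fin n)))
    (Φ : Set (EuclideanSpace ℝ (Fin n)) → ℝ≥0) : Prop :=
  ∃ C : ℝ≥0, ∀ A, IsOpen A → Bornology.IsBounded A → A ⊆ V → Φ A ≤ C

/-- The set function `Φ`, considered on the open bounded subsets of `V`, is monotone. -/
def IsMonotoneSetFunction {n : ℕ} (V : Set (EuclideanSpace ℝ (Fin n)))
    (Φ : Set (EuclideanSpace ℝ (Fin n)) → ℝ≥0) : Prop :=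
  ∀ A B, IsOpen A → IsOpen B → Bornology.IsBounded B → A ⊆ B → B ⊆ V → Φ A ≤ Φ B

/-- The set function `Φ`, considered on the open bounded subsets of `V`, is countably additive.
(The sets `A i` may be empty, so that `Φ ∅ = 0` and finite additivity are included.) -/
def IsCountablyAdditiveSetFunction {n : ℕ} (V : Set (EuclideanSpace ℝ (Fin n)))
    (Φ : Set (EuclideanSpace ℝ (Fin n)) → ℝ≥0) : Prop :=
  ∀ A : ℕ → Set (EuclideanSpace ℝ (Fin n)), (∀ i, IsOpen (A i)) → (∀ i, A i ⊆ V) →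
    Pairwise (fun i j => Disjoint (A i) (A j)) → Bornology.IsBounded (⋃ i, A i) →
    HasSum (fun i => Φ (A i)) (Φ (⋃ i, A i))

/-!
Let `U = D ∩ φ⁻¹(A')`, let `g_j` be the weak gradient of the `j`-th coordinate of `φ`, and put
`S = ∑ i, ∑ j, |∂_i φ_j| ∈ L_p(D)`. The set function is `Φ(A') = ∫_{D ∩ φ⁻¹(A')} S ^ p`, the value
of a finite measure on a preimage, so it is bounded, monotone and countably additive. What has to
be shown is the chain rule inequality `|∇(f ∘ φ)| ≤ K S` almost everywhere on `U`, together with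
the existence of the weak gradient on the left, whenever `f` is `K`-Lipschitz along the segments
contained in `A'`.

Both follow from one estimate on test functions `η` on `U`, with `u = f ∘ φ`
(`abs_integral_comp_mul_fderiv_le`):
`|∫ u ∂_i η| ≤ ∫ K (∑ j, |∂_i φ_j|) |η|`.
Its left side is the limit of `∫ (u(x + t e_i) - u(x)) / t * η(x) dx` in absolute value, and for
`x` in the compact support of `η` and small `t` the segment from `φ(x)` to `φ(x + t e_i)` lies in
`A'`, so the difference quotient of `u` is at most `K` times the sum of those of the `φ_j`. These in
turn are bounded almost everywhere by averages of `|∂_i φ_j|` over the segment from `x` to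
`x + t e_i` (`HasWeakGradient.ae_enorm_translate_sub_le`); this is obtained by duality, since
`s ↦ ∫ w(y) ζ(y - s v) dy` has derivative `∫ ⟨v, ∇w(y)⟩ ζ(y - s v) dy` for test functions `ζ`.

The estimate says that `η ↦ -∫ u ∂_i η` is a functional dominated by a weighted `L¹` norm. By the
Hahn-Banach and Riesz theorems in a weighted `L²` space it is integration against a locally
integrable function (`exists_integral_eq_of_abs_le_integral`), the weak partial derivative of `u`.
Testing against approximate identities turns the estimate into the pointwise bound, for every weak
gradient of `u` (`ae_abs_le_of_abs_integral_mul_test_le`).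

The constant `K` is used twice. Any number above the seminorm of `f` is admissible
(`abs_sub_le_of_lipSeminorm_lt`) and gives that `u` belongs to `L¹_p(U)`; the essential supremum of
`|∇f|` is admissible too, if finite (`HasWeakGradient.abs_sub_le_of_ae_norm_le`), and gives the
inequality with `Φ`.
-/

section Composition

variable {n : ℕ}

/-! ### Pointwise bounds from testing against smooth functions -/

/-- The reflected and translated bump `y ↦ ψ(x - y)`, whose integral against `F` is the
mollification of `F` at `x`. -/
theorem isTestFunction_normed_sub {U : Set (EuclideanSpace ℝ (Fin n))}
    (ψ : ContDiffBump (0 : EuclideanSpace ℝ (Fin n))) (x : EuclideanSpace ℝ (Fin n))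
    (h : Metric.closedBall x ψ.rOut ⊆ U) :
    IsTestFunction U (fun y => ψ.normed volume (x - y)) ∧
      tsupport (fun y => ψ.normed volume (x - y)) ⊆ Metric.closedBall x ψ.rOut := by
  have hs : tsupport (fun y => ψ.normed volume (x - y)) ⊆ Metric.closedBall x ψ.rOut := by
    refine closure_minimal ?_ Metric.isClosed_closedBall
    intro y hy
    have hy' : x - y ∈ Function.support (ψ.normed volume) := hy
    rw [ψ.support_normed_eq, mem_ball_zero_iff] at hy'
    rw [Metric.mem_closedBall, dist_eq_norm, norm_sub_rev]
    exact hy'.le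
  refine ⟨⟨?_, ?_, hs.trans h⟩, hs⟩
  · exact ψ.contDiff_normed.comp (contDiff_const.sub contDiff_id)
  · exact HasCompactSupport.of_support_subset_isCompact (isCompact_closedBall x ψ.rOut)
      ((subset_tsupport _).trans hs)

/-- The mollification at `x` of `F`, cut off outside `K`, is the integral of `F` over `U` against a
test function on `U`. The cut-off matters because `F` is only controlled inside `U`. -/
theorem normed_convolution_indicator {U K : Set (EuclideanSpace ℝ (Fin n))}
    (hU : MeasurableSet U) (hK : K ⊆ U)
    (ψ : ContDiffBump (0 : EuclideanSpace ℝ (Fin n))) (x : EuclideanSpace ℝ (Fin n))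
    (h : Metric.closedBall x ψ.rOut ⊆ K) (F : EuclideanSpace ℝ (Fin n) → ℝ) :
    (MeasureTheory.convolution (ψ.normed volume) (K.indicator F)
      (ContinuousLinearMap.lsmul ℝ ℝ) volume) x =
      ∫ y in U, F y * ψ.normed volume (x - y) := by
  rw [convolution_eq_swap, ← integral_indicator hU]
  congr 1 with y
  simp only [ContinuousLinearMap.lsmul_apply, smul_eq_mul]
  by_cases hy : y ∈ K
  · rw [indicator_of_mem hy, indicator_of_mem (hK hy), mul_comm]
  · have : ψ.normed volume (x - y) = 0 := by
      by_contra h0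
      have hy' : x - y ∈ Function.support (ψ.normed volume) := h0
      rw [ψ.support_normed_eq, mem_ball_zero_iff] at hy'
      refine hy (h ?_)
      rw [Metric.mem_closedBall, dist_eq_norm, norm_sub_rev]
      exact hy'.le
    rw [indicator_of_notMem hy]
    by_cases hyU : y ∈ U
    · rw [indicator_of_mem hyU, this]; simp
    · rw [indicator_of_notMem hyU]; simp

/-- Mollifications at points of `U` with small radius are nonnegative, and they converge almost
everywhere by Lebesgue differentiation. -/
theorem ae_nonneg_of_integral_mul_test_nonneg {U : Set (EuclideanSpace ℝ (Fin n))}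
    (hU : IsOpen U) {F : EuclideanSpace ℝ (Fin n) → ℝ} (hF : LocallyIntegrableOn F U volume)
    (h : ∀ η : EuclideanSpace ℝ (Fin n) → ℝ, IsTestFunction U η → (∀ x, 0 ≤ η x) →
      0 ≤ ∫ x in U, F x * η x) :
    ∀ᵐ x ∂(volume.restrict U), 0 ≤ F x := by
  rw [ae_restrict_iff' hU.measurableSet, ae_iff]
  refine measure_null_of_locally_null _ ?_
  intro x₀ hx₀
  have hx₀U : x₀ ∈ U := by
    by_contra hc
    exact hx₀ (fun h => absurd h hc)
  obtain ⟨r, hr, hrU⟩ := Metric.nhds_basis_closedBall.mem_iff.1 (hU.mem_nhds hx₀U)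
  refine ⟨{a | ¬(a ∈ U → 0 ≤ F a)} ∩ Metric.ball x₀ (r / 2),
    inter_mem self_mem_nhdsWithin
      (mem_nhdsWithin_of_mem_nhds (Metric.ball_mem_nhds _ (by positivity))), ?_⟩
  -- Lebesgue differentiation needs outer radii comparable to the inner ones.
  let ψ : ℕ → ContDiffBump (0 : EuclideanSpace ℝ (Fin n)) := fun k =>
    ⟨1 / ((k : ℝ) + 1), 2 / ((k : ℝ) + 1), by positivity, by gcongr; norm_num⟩
  have hψ : Tendsto (fun k => (ψ k).rOut) atTop (𝓝 0) := by
    have := (tendsto_one_div_add_atTop_nhds_zero_nat (𝕜 := ℝ)).const_mul 2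
    simpa [ψ, div_eq_mul_inv] using this
  have hint : Integrable ((Metric.closedBall x₀ r).indicator F) volume :=
    (integrable_indicator_iff Metric.isClosed_closedBall.measurableSet).2
      (hF.integrableOn_compact_subset hrU (isCompact_closedBall x₀ r))
  have key := ContDiffBump.ae_convolution_tendsto_right_of_locallyIntegrable (μ := volume)
    (K := 2) hψ (Eventually.of_forall fun k => by
      change 2 / ((k : ℝ) + 1) ≤ 2 * (1 / ((k : ℝ) + 1)); apply le_of_eq; ring)
    hint.locallyIntegrable
  rw [ae_iff] at key
  refine measure_mono_null ?_ key
  rintro x ⟨hx1, hx2⟩ hx3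
  refine hx1 fun hxU => ?_
  have hxr : x ∈ Metric.closedBall x₀ r :=
    Metric.ball_subset_closedBall (Metric.ball_subset_ball (by linarith) hx2)
  rw [indicator_of_mem hxr] at hx3
  refine ge_of_tendsto hx3 ?_
  filter_upwards [hψ.eventually (gt_mem_nhds (half_pos hr))] with k hk
  have hsub : Metric.closedBall x (ψ k).rOut ⊆ Metric.closedBall x₀ r := by
    refine Metric.closedBall_subset_closedBall' ?_
    have := Metric.mem_ball.1 hx2
    linarith
  rw [normed_convolution_indicator hU.measurableSet hrU (ψ k) x hsub F]
  exact h _ (isTestFunction_normed_sub (ψ k) x (hsub.trans hrU)).1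
    fun y => (ψ k).nonneg_normed _

theorem integrable_mul_of_tsupport_subset {U : Set (EuclideanSpace ℝ (Fin n))}
    {η F : EuclideanSpace ℝ (Fin n) → ℝ} (hη : Continuous η) (hc : HasCompactSupport η)
    (hs : tsupport η ⊆ U) (hF : LocallyIntegrableOn F U volume) :
    Integrable (fun x => F x * η x) volume := by
  have h1 : IntegrableOn (fun x => F x * η x) (tsupport η) volume :=
    (hF.integrableOn_compact_subset hs hc).mul_continuousOn hη.continuousOn hc
  refine (integrableOn_iff_integrable_of_support_subset ?_).1 h1
  intro x hx
  by_contra hc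
  exact hx (by simp [image_eq_zero_of_notMem_tsupport hc])

theorem ae_abs_le_of_abs_integral_mul_test_le {U : Set (EuclideanSpace ℝ (Fin n))}
    (hU : IsOpen U) {G h : EuclideanSpace ℝ (Fin n) → ℝ} (hG : LocallyIntegrableOn G U volume)
    (hh : LocallyIntegrableOn h U volume)
    (hle : ∀ η : EuclideanSpace ℝ (Fin n) → ℝ, IsTestFunction U η →
      |∫ x in U, G x * η x| ≤ ∫ x in U, h x * |η x|) :
    ∀ᵐ x ∂(volume.restrict U), |G x| ≤ h x := by
  have h1 := ae_nonneg_of_integral_mul_test_nonneg hU (hh.sub hG) (by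
    intro η hη h0
    have hi1 := (integrable_mul_of_tsupport_subset hη.1.continuous hη.2.1 hη.2.2
      hh).integrableOn (s := U)
    have hi2 := (integrable_mul_of_tsupport_subset hη.1.continuous hη.2.1 hη.2.2
      hG).integrableOn (s := U)
    have := hle η hη
    simp only [abs_of_nonneg (h0 _)] at this
    simp only [Pi.sub_apply, sub_mul]
    rw [integral_sub hi1 hi2]
    linarith [(abs_le.1 this).2])
  have h2 := ae_nonneg_of_integral_mul_test_nonneg hU (hh.add hG) (by
    intro η hη h0
    have hi1 := (integrable_mul_of_tsupport_subset hη.1.continuous hη.2.1 hη.2.2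
      hh).integrableOn (s := U)
    have hi2 := (integrable_mul_of_tsupport_subset hη.1.continuous hη.2.1 hη.2.2
      hG).integrableOn (s := U)
    have := hle η hη
    simp only [abs_of_nonneg (h0 _)] at this
    simp only [Pi.add_apply, add_mul]
    rw [integral_add hi1 hi2]
    linarith [(abs_le.1 this).1])
  filter_upwards [h1, h2] with x hx1 hx2
  simp only [Pi.add_apply, Pi.sub_apply] at hx1 hx2
  exact abs_le.2 ⟨by linarith, by linarith⟩

/-! ### Representing functionals dominated by an integral -/

/-- The real vector space `C₀^∞(U)`, as a subspace of all functions. -/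
def testSubmodule (U : Set (EuclideanSpace ℝ (Fin n))) :
    Submodule ℝ (EuclideanSpace ℝ (Fin n) → ℝ) where
  carrier := {η | IsTestFunction U η}
  add_mem' {a b} ha hb := ⟨ha.1.add hb.1, ha.2.1.add hb.2.1,
    (tsupport_add a b).trans (union_subset ha.2.2 hb.2.2)⟩
  zero_mem' := ⟨contDiff_const, HasCompactSupport.zero, by simp [tsupport]⟩
  smul_mem' c a ha := ⟨ha.1.const_smul c, ha.2.1.smul_left (f := fun _ => c),
    (tsupport_smul_subset_right (fun _ => c) a).trans ha.2.2⟩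

/-- A functional bounded by the seminorm pulled back from a Hilbert space factors through the range,
extends by Hahn-Banach and is represented by a vector. -/
theorem exists_inner_eq_of_abs_le_norm {V H : Type*} [AddCommGroup V] [Module ℝ V]
    [NormedAddCommGroup H] [InnerProductSpace ℝ H] [CompleteSpace H]
    (ι : V →ₗ[ℝ] H) (T : V →ₗ[ℝ] ℝ) (C : ℝ) (hT : ∀ v, |T v| ≤ C * ‖ι v‖) :
    ∃ g : H, ∀ v, T v = inner ℝ g (ι v) := by
  have hker : LinearMap.ker ι ≤ LinearMap.ker T := by
    intro v hv
    have := hT v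
    rw [LinearMap.mem_ker.1 hv, norm_zero, mul_zero] at this
    exact LinearMap.mem_ker.2 (abs_nonpos_iff.1 this)
  let T' : LinearMap.range ι →ₗ[ℝ] ℝ :=
    (LinearMap.ker ι).liftQ T hker ∘ₗ ι.quotKerEquivRange.symm.toLinearMap
  have hT' : ∀ v, T' ⟨ι v, LinearMap.mem_range_self ι v⟩ = T v := by
    intro v
    have : ι.quotKerEquivRange.symm ⟨ι v, LinearMap.mem_range_self ι v⟩ =
        (LinearMap.ker ι).mkQ v := by
      rw [LinearEquiv.symm_apply_eq]; rfl
    change (LinearMap.ker ι).liftQ T hker (ι.quotKerEquivRange.symm _) = _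
    rw [this]; simp
  let T'' : StrongDual ℝ (LinearMap.range ι) := T'.mkContinuous C (by
    rintro ⟨_, v, rfl⟩
    rw [hT' v]
    exact hT v)
  obtain ⟨S, hS, -⟩ := exists_extension_norm_eq (LinearMap.range ι) T''
  refine ⟨(InnerProductSpace.toDual ℝ H).symm S, fun v => ?_⟩
  rw [InnerProductSpace.toDual_symm_apply, ← hT' v]
  exact (hS ⟨ι v, LinearMap.mem_range_self ι v⟩).symm

/-- A functional on `C₀^∞(U)` dominated by `η ↦ ∫ h |η|` is integration against a locally integrable
function. As `∫_U h` may be infinite, a positive continuous weight `ρ` with `∫_U h ρ < ∞` is used: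
for the measure `μ = (h / ρ) dx` on `U`, the Cauchy-Schwarz inequality
`∫ h |η| dx = ∫ ρ |η| dμ ≤ ‖ρ‖ ‖η‖` in `L²(μ)` makes the functional bounded on `L²(μ)`. -/
theorem exists_integral_eq_of_abs_le_integral {U : Set (EuclideanSpace ℝ (Fin n))}
    (hU : IsOpen U) {h ρ : EuclideanSpace ℝ (Fin n) → ℝ} (hh : ∀ x, 0 ≤ h x)
    (hm : AEStronglyMeasurable h (volume.restrict U))
    (hρ : Continuous ρ) (hρ0 : ∀ x, 0 < ρ x)
    (hint : IntegrableOn (fun x => h x * ρ x) U volume)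
    (T : testSubmodule U →ₗ[ℝ] ℝ)
    (hT : ∀ η : testSubmodule U, |T η| ≤ ∫ x in U, h x * |(η : EuclideanSpace ℝ (Fin n) → ℝ) x|) :
    ∃ g : EuclideanSpace ℝ (Fin n) → ℝ, LocallyIntegrableOn g U volume ∧
      ∀ η : testSubmodule U, T η = ∫ x in U, g x * (η : EuclideanSpace ℝ (Fin n) → ℝ) x := by
  have hρi : Continuous fun x => (ρ x)⁻¹ := hρ.inv₀ fun x => (hρ0 x).ne'
  let q : EuclideanSpace ℝ (Fin n) → ℝ≥0 := fun x => (h x * (ρ x)⁻¹).toNNReal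
  have hqc : ∀ x, (q x : ℝ) = h x * (ρ x)⁻¹ := fun x =>
    Real.coe_toNNReal _ (mul_nonneg (hh x) (inv_nonneg.2 (hρ0 x).le))
  have hq : AEMeasurable q (volume.restrict U) :=
    (hm.aemeasurable.mul hρi.aemeasurable).real_toNNReal
  let μ : Measure (EuclideanSpace ℝ (Fin n)) :=
    (volume.restrict U).withDensity fun x => (q x : ℝ≥0∞)
  have hac : μ ≪ volume.restrict U := withDensity_absolutelyContinuous _ _
  have hρL : MemLp ρ 2 μ := by
    rw [memLp_two_iff_integrable_sq hρ.aestronglyMeasurable,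
      integrable_withDensity_iff_integrable_smul₀ hq]
    refine hint.congr (Eventually.of_forall fun x => ?_)
    simp only [NNReal.smul_def, hqc, smul_eq_mul]
    have := (hρ0 x).ne'
    field_simp
  have hηL : ∀ η : EuclideanSpace ℝ (Fin n) → ℝ, Continuous η → HasCompactSupport η →
      MemLp η 2 μ := by
    intro η hη hc
    rw [memLp_two_iff_integrable_sq hη.aestronglyMeasurable,
      integrable_withDensity_iff_integrable_smul₀ hq]
    have hcont : Continuous fun x => (ρ x)⁻¹ ^ 2 * η x ^ 2 := (hρi.pow 2).mul (hη.pow 2)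
    obtain ⟨C, hC⟩ := (HasCompactSupport.intro (K := tsupport η) hc (fun x hx => by
      simp [image_eq_zero_of_notMem_tsupport hx]) :
        HasCompactSupport fun x => (ρ x)⁻¹ ^ 2 * η x ^ 2).exists_bound_of_continuous hcont
    refine (hint.bdd_mul hcont.aestronglyMeasurable (Eventually.of_forall hC)).congr
      (Eventually.of_forall fun x => ?_)
    simp only [NNReal.smul_def, hqc, smul_eq_mul]
    have := (hρ0 x).ne'
    field_simp
  let ι : testSubmodule U →ₗ[ℝ] Lp ℝ 2 μ :=
    { toFun := fun η => (hηL η.1 η.2.1.continuous η.2.2.1).toLp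
      map_add' := fun a b => MemLp.toLp_add _ _
      map_smul' := fun c a => MemLp.toLp_const_smul c _ }
  have hι : ∀ η : testSubmodule U, ι η = (hηL η.1 η.2.1.continuous η.2.2.1).toLp := fun _ => rfl
  have hbound : ∀ η : testSubmodule U, |T η| ≤ ‖hρL.toLp‖ * ‖ι η‖ := by
    intro η
    have habs := (hηL η.1 η.2.1.continuous η.2.2.1).norm
    have hnorm : ‖habs.toLp‖ = ‖ι η‖ := by
      rw [hι, Lp.norm_toLp, Lp.norm_toLp, eLpNorm_norm]
    refine (hT η).trans ?_
    rw [← hnorm]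
    refine le_trans (le_of_eq ?_) (real_inner_le_norm (hρL.toLp) habs.toLp)
    rw [L2.inner_def]
    have e1 : ∫ a, inner ℝ ((hρL.toLp : Lp ℝ 2 μ) a) ((habs.toLp : Lp ℝ 2 μ) a) ∂μ =
        ∫ a, ρ a * |η.1 a| ∂μ := by
      refine integral_congr_ae ?_
      filter_upwards [hρL.coeFn_toLp, habs.coeFn_toLp] with x hx1 hx2
      rw [hx1, hx2]
      simp [mul_comm]
    rw [e1, integral_withDensity_eq_integral_smul₀ hq]
    refine integral_congr_ae (Eventually.of_forall fun x => ?_)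
    simp only [NNReal.smul_def, hqc, smul_eq_mul]
    have := (hρ0 x).ne'
    field_simp
  obtain ⟨g, hg⟩ := exists_inner_eq_of_abs_le_norm ι T _ hbound
  refine ⟨fun x => q x • g x, ?_, fun η => ?_⟩
  · have h1 : Integrable (fun x => ρ x * g x) μ := hρL.integrable_mul (Lp.memLp g)
    rw [integrable_withDensity_iff_integrable_smul₀ hq] at h1
    have h2 : LocallyIntegrableOn (fun x => q x • (ρ x * g x)) U volume :=
      IntegrableOn.locallyIntegrableOn h1
    refine (h2.continuousOn_mul hρi.continuousOn hU.isLocallyClosed).congr ?_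
    refine Eventually.of_forall fun x => ?_
    simp only [NNReal.smul_def, smul_eq_mul]
    have := (hρ0 x).ne'
    field_simp
  · rw [hg η, L2.inner_def]
    have e1 : ∫ a, inner ℝ (g a) ((ι η : Lp ℝ 2 μ) a) ∂μ = ∫ a, g a * η.1 a ∂μ := by
      refine integral_congr_ae ?_
      filter_upwards [(hηL η.1 η.2.1.continuous η.2.2.1).coeFn_toLp] with x hx1
      rw [hι, hx1]
      simp [mul_comm]
    rw [e1, integral_withDensity_eq_integral_smul₀ hq]
    refine integral_congr_ae (Eventually.of_forall fun x => ?_)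
    simp only [NNReal.smul_def, smul_eq_mul]
    ring

/-! ### Translating a test function -/

theorem hasDerivAt_integral_mul_translate {w η : EuclideanSpace ℝ (Fin n) → ℝ}
    (hw : Integrable w volume) (hη : ContDiff ℝ ∞ η) (hc : HasCompactSupport η)
    (v : EuclideanSpace ℝ (Fin n)) (s₀ : ℝ) :
    HasDerivAt (fun s : ℝ => ∫ y, w y * η (y - s • v))
      (-∫ y, w y * fderiv ℝ η (y - s₀ • v) v) s₀ := by
  have hd : Continuous (fderiv ℝ η) := hη.continuous_fderiv (by simp)
  obtain ⟨C, hC⟩ := hc.exists_bound_of_continuous hη.continuous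
  obtain ⟨C', hC'⟩ := (hc.fderiv ℝ).exists_bound_of_continuous hd
  rw [← integral_neg]
  have hmeas : ∀ s : ℝ, AEStronglyMeasurable (fun y => w y * η (y - s • v)) volume := fun s =>
    hw.aestronglyMeasurable.mul (hη.continuous.comp (by fun_prop)).aestronglyMeasurable
  refine (hasDerivAt_integral_of_dominated_loc_of_deriv_le (μ := volume)
    (F := fun (s : ℝ) y => w y * η (y - s • v))
    (F' := fun (s : ℝ) y => -(w y * fderiv ℝ η (y - s • v) v))
    (bound := fun y => ‖w y‖ * (C' * ‖v‖)) (s := univ) univ_mem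
    (Eventually.of_forall hmeas) ?_ ?_ ?_ ?_ ?_).2
  · exact (hw.mul_bdd (hη.continuous.comp (by fun_prop)).aestronglyMeasurable
      (Eventually.of_forall fun y => hC _))
  · exact (hw.aestronglyMeasurable.mul
      ((hd.comp (by fun_prop)).clm_apply continuous_const).aestronglyMeasurable).neg
  · refine Eventually.of_forall fun y s _ => ?_
    rw [norm_neg, norm_mul]
    gcongr
    exact (ContinuousLinearMap.le_opNorm _ _).trans (by gcongr; exact hC' _)
  · exact hw.norm.mul_const _
  · refine Eventually.of_forall fun y s _ => ?_
    have h1 : HasDerivAt (fun s : ℝ => y - s • v) (-v) s := by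
      simpa using ((hasDerivAt_id s).smul_const v).const_sub y
    have h2 := ((hη.differentiable (by simp) (y - s • v)).hasFDerivAt.comp_hasDerivAt s h1)
    simpa using h2.const_mul (w y)

theorem continuous_integral_mul_translate {w η : EuclideanSpace ℝ (Fin n) → ℝ}
    (hw : Integrable w volume) (hη : ContDiff ℝ ∞ η) (hc : HasCompactSupport η)
    (v : EuclideanSpace ℝ (Fin n)) :
    Continuous (fun s : ℝ => ∫ y, w y * η (y - s • v)) :=
  continuous_iff_continuousAt.2 fun s =>
    (hasDerivAt_integral_mul_translate hw hη hc v s).continuousAt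

theorem IsTestFunction.translate {U : Set (EuclideanSpace ℝ (Fin n))}
    {η : EuclideanSpace ℝ (Fin n) → ℝ} (hη : ContDiff ℝ ∞ η) (hc : HasCompactSupport η)
    (v : EuclideanSpace ℝ (Fin n)) (h : ∀ x ∈ tsupport η, x + v ∈ U) :
    IsTestFunction U (fun y => η (y - v)) := by
  refine ⟨hη.comp (contDiff_id.sub contDiff_const),
    hc.comp_homeomorph (Homeomorph.subRight v), ?_⟩
  have : tsupport (fun y => η (y - v)) = (Homeomorph.subRight v) ⁻¹' tsupport η :=
    tsupport_comp_eq_preimage η (Homeomorph.subRight v)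
  rw [this]
  intro y hy
  simpa using h _ hy

theorem locallyIntegrableOn_apply {U : Set (EuclideanSpace ℝ (Fin n))}
    {g : EuclideanSpace ℝ (Fin n) → EuclideanSpace ℝ (Fin n)}
    (hg : LocallyIntegrableOn g U volume) (i : Fin n) :
    LocallyIntegrableOn (fun x => g x i) U volume := fun x hx => by
  obtain ⟨s, hs, hs'⟩ := hg x hx
  exact ⟨s, hs, (EuclideanSpace.proj (𝕜 := ℝ) i).integrable_comp hs'⟩

/-- The defining identity of the weak gradient, for derivatives in an arbitrary direction. -/
theorem HasWeakGradient.integral_fderiv_eq {U : Set (EuclideanSpace ℝ (Fin n))}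
    {w : EuclideanSpace ℝ (Fin n) → ℝ} {g : EuclideanSpace ℝ (Fin n) → EuclideanSpace ℝ (Fin n)}
    (hw : HasWeakGradient U w g) {η : EuclideanSpace ℝ (Fin n) → ℝ} (hη : IsTestFunction U η)
    (v : EuclideanSpace ℝ (Fin n)) :
    ∫ x in U, w x * fderiv ℝ η x v = -∫ x in U, inner ℝ v (g x) * η x := by
  have hd : Continuous (fderiv ℝ η) := hη.1.continuous_fderiv (by simp)
  have hv : v = ∑ i, v i • EuclideanSpace.single i (1 : ℝ) := by
    simpa using ((EuclideanSpace.basisFun (Fin n) ℝ).sum_repr v).symm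
  have e1 : ∀ x, w x * fderiv ℝ η x v =
      ∑ i, v i * (w x * fderiv ℝ η x (EuclideanSpace.single i 1)) := by
    intro x
    conv_lhs => rw [hv]
    rw [map_sum, Finset.mul_sum]
    refine Finset.sum_congr rfl fun i _ => ?_
    rw [map_smul, smul_eq_mul]; ring
  have e2 : ∀ x, inner ℝ v (g x) * η x = ∑ i, v i * (g x i * η x) := by
    intro x
    rw [PiLp.inner_apply, Finset.sum_mul]
    refine Finset.sum_congr rfl fun i _ => ?_
    simp; ring
  simp_rw [e1, e2]
  rw [integral_finsetSum, integral_finsetSum, ← Finset.sum_neg_distrib]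
  · refine Finset.sum_congr rfl fun i _ => ?_
    rw [integral_const_mul, integral_const_mul, hw.integral_eq η hη i, mul_neg]
  · intro i _
    exact ((integrable_mul_of_tsupport_subset hη.1.continuous hη.2.1 hη.2.2
      (locallyIntegrableOn_apply hw.locallyIntegrableOn_grad i)).integrableOn).const_mul _
  · intro i _
    refine ((integrable_mul_of_tsupport_subset (hd.clm_apply continuous_const)
      (hη.2.1.fderiv_apply ℝ _) ((tsupport_fderiv_apply_subset ℝ _).trans hη.2.2)
      hw.locallyIntegrableOn).integrableOn).const_mul _

theorem setIntegral_mul_eq_integral_indicator_mul {U L : Set (EuclideanSpace ℝ (Fin n))}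
    (hU : MeasurableSet U) (hLU : L ⊆ U) (w : EuclideanSpace ℝ (Fin n) → ℝ)
    {ζ : EuclideanSpace ℝ (Fin n) → ℝ} (hζ : Function.support ζ ⊆ L) :
    ∫ x in U, w x * ζ x = ∫ x, L.indicator w x * ζ x := by
  rw [← integral_indicator hU]
  congr 1 with x
  by_cases hx : x ∈ L
  · rw [indicator_of_mem hx, indicator_of_mem (hLU hx)]
  · have : ζ x = 0 := by
      by_contra h0; exact hx (hζ h0)
    simp [indicator, this]

/-- The weak form of `w(x + t v) - w(x) = ∫₀ᵗ ⟨v, ∇w(x + s v)⟩ ds`, tested against `η`. The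
compact set `L` contains all translates of the support of `η`, so `w` and its gradient may be cut off
outside `L` and become globally integrable. -/
theorem HasWeakGradient.integral_translate_sub {U L : Set (EuclideanSpace ℝ (Fin n))}
    (hU : IsOpen U) (hL : IsCompact L) (hLU : L ⊆ U)
    {w : EuclideanSpace ℝ (Fin n) → ℝ} {g : EuclideanSpace ℝ (Fin n) → EuclideanSpace ℝ (Fin n)}
    (hw : HasWeakGradient U w g) {η : EuclideanSpace ℝ (Fin n) → ℝ}
    (hη : ContDiff ℝ ∞ η) (hc : HasCompactSupport η) (v : EuclideanSpace ℝ (Fin n))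
    {t : ℝ} (ht : 0 ≤ t) (hs : ∀ s ∈ Icc 0 t, ∀ x ∈ tsupport η, x + s • v ∈ L) :
    (∫ y, L.indicator w y * η (y - t • v)) - ∫ y, L.indicator w y * η y =
      ∫ s in (0 : ℝ)..t, ∫ y, L.indicator (fun x => inner ℝ v (g x)) y * η (y - s • v) := by
  have hwi : Integrable (L.indicator w) volume := (integrable_indicator_iff hL.measurableSet).2
    (hw.locallyIntegrableOn.integrableOn_compact_subset hLU hL)
  have hgi : Integrable (L.indicator (fun x => inner ℝ v (g x))) volume :=
    (integrable_indicator_iff hL.measurableSet).2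
      ((innerSL ℝ v).integrable_comp
        (hw.locallyIntegrableOn_grad.integrableOn_compact_subset hLU hL))
  have key := intervalIntegral.integral_eq_sub_of_hasDerivAt (a := 0) (b := t)
    (f := fun s : ℝ => ∫ y, L.indicator w y * η (y - s • v))
    (f' := fun s => ∫ y, L.indicator (fun x => inner ℝ v (g x)) y * η (y - s • v)) ?_
    ((continuous_integral_mul_translate hgi hη hc v).intervalIntegrable _ _)
  · rw [key]; simp
  · intro s hs'
    rw [uIcc_of_le ht] at hs'
    have hD := hasDerivAt_integral_mul_translate hwi hη hc v s
    have htest : IsTestFunction L (fun y => η (y - s • v)) :=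
      IsTestFunction.translate hη hc (s • v) (hs s hs')
    have h1 := hw.integral_fderiv_eq ⟨htest.1, htest.2.1, htest.2.2.trans hLU⟩ v
    have h2 : ∀ x, fderiv ℝ (fun y => η (y - s • v)) x = fderiv ℝ η (x - s • v) := fun x =>
      fderiv_comp_sub (f := η) (x := x) (s • v)
    rw [setIntegral_mul_eq_integral_indicator_mul hU.measurableSet hLU _
      ((subset_tsupport _).trans htest.2.2),
      setIntegral_mul_eq_integral_indicator_mul hU.measurableSet hLU _
      ((subset_tsupport _).trans ((tsupport_fderiv_apply_subset ℝ v).trans htest.2.2))] at h1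
    simp_rw [h2] at h1
    rw [h1, neg_neg] at hD
    exact hD

/-- Tonelli's theorem and translation invariance. -/
theorem lintegral_translate_swap {g k : EuclideanSpace ℝ (Fin n) → ℝ≥0∞}
    (hg : Measurable g) (hk : Measurable k) (v : EuclideanSpace ℝ (Fin n)) (t : ℝ) :
    ∫⁻ s in Ioc (0 : ℝ) t, ∫⁻ y, g y * k (y - s • v) =
      ∫⁻ x, (∫⁻ s in Ioc (0 : ℝ) t, g (x + s • v)) * k x := by
  have h1 : ∀ s : ℝ, ∫⁻ y, g y * k (y - s • v) = ∫⁻ x, g (x + s • v) * k x := by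
    intro s
    rw [← lintegral_add_right_eq_self (fun y => g y * k (y - s • v)) (s • v)]
    simp
  simp_rw [h1]
  rw [lintegral_lintegral_swap]
  · refine lintegral_congr fun x => ?_
    rw [lintegral_mul_const]
    exact hg.comp (by fun_prop)
  · refine Measurable.aemeasurable ?_
    exact (hg.comp (by fun_prop : Measurable fun p : ℝ × EuclideanSpace ℝ (Fin n) =>
      p.2 + p.1 • v)).mul (hk.comp measurable_snd)

/-! ### Lipschitz bounds along segments -/

theorem exists_cthickening_segment {A : Set (EuclideanSpace ℝ (Fin n))} (hA : IsOpen A)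
    {x y : EuclideanSpace ℝ (Fin n)} (hseg : segment ℝ x y ⊆ A) :
    ∃ δ, 0 < δ ∧ Metric.cthickening δ (segment ℝ x y) ⊆ A ∧
      IsCompact (Metric.cthickening δ (segment ℝ x y)) := by
  have hK : IsCompact (segment ℝ x y) := by
    rw [segment_eq_image_lineMap]
    exact isCompact_Icc.image AffineMap.lineMap_continuous
  obtain ⟨δ, hδ, h⟩ := hK.exists_cthickening_subset_open hA hseg
  exact ⟨δ, hδ, h, hK.cthickening⟩

/-- A continuous function with weak gradient bounded by `M` is `M`-Lipschitz along the segments in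
its domain: this holds for its mollifications at the end points, and these converge by continuity.
-/
theorem HasWeakGradient.abs_sub_le_of_ae_norm_le {A : Set (EuclideanSpace ℝ (Fin n))}
    (hA : IsOpen A) {f : EuclideanSpace ℝ (Fin n) → ℝ} (hf : ContinuousOn f A)
    {G : EuclideanSpace ℝ (Fin n) → EuclideanSpace ℝ (Fin n)} (hG : HasWeakGradient A f G)
    {M : ℝ} (hM : ∀ᵐ x ∂(volume.restrict A), ‖G x‖ ≤ M)
    {x y : EuclideanSpace ℝ (Fin n)} (hseg : segment ℝ x y ⊆ A) :
    |f y - f x| ≤ M * ‖y - x‖ := by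
  obtain ⟨δ, hδ, hLA, hL⟩ := exists_cthickening_segment hA hseg
  set L := Metric.cthickening δ (segment ℝ x y) with hLdef
  refine le_of_forall_pos_le_add fun ε hε => ?_
  have hloc : ∀ z ∈ segment ℝ x y, ∀ᶠ r in 𝓝[>] (0 : ℝ), ∀ a ∈ Metric.ball z r,
      dist (f a) (f z) ≤ ε / 2 := by
    intro z hz
    have hc : ContinuousAt f z := hf.continuousAt (hA.mem_nhds (hseg hz))
    obtain ⟨r, hr, h⟩ := Metric.eventually_nhds_iff.1
      (hc.eventually (Metric.closedBall_mem_nhds _ (half_pos hε)))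
    filter_upwards [Ioo_mem_nhdsGT hr] with r' hr' a ha
    exact h ((Metric.mem_ball.1 ha).trans hr'.2)
  have hx : x ∈ segment ℝ x y := left_mem_segment ℝ x y
  have hy : y ∈ segment ℝ x y := right_mem_segment ℝ x y
  obtain ⟨r, hrx, hry, hr⟩ := ((hloc x hx).and ((hloc y hy).and (Ioo_mem_nhdsGT hδ))).exists
  let ψ : ContDiffBump (0 : EuclideanSpace ℝ (Fin n)) :=
    ⟨r / 2, r, half_pos hr.1, half_lt_self hr.1⟩
  have hball : ∀ z ∈ segment ℝ x y, Metric.closedBall z ψ.rOut ⊆ L := fun z hz =>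
    (Metric.closedBall_subset_closedBall hr.2.le).trans
      (Metric.closedBall_subset_cthickening hz δ)
  have hfi : Integrable (L.indicator f) volume := (integrable_indicator_iff hL.measurableSet).2
    (hG.locallyIntegrableOn.integrableOn_compact_subset hLA hL)
  have happ : ∀ z ∈ segment ℝ x y, (∀ a ∈ Metric.ball z r, dist (f a) (f z) ≤ ε / 2) →
      |(∫ a, L.indicator f a * ψ.normed volume (z - a)) - f z| ≤ ε / 2 := by
    intro z hz h
    have hzL : z ∈ L := hball z hz (Metric.mem_closedBall_self hr.1.le)
    have := ContDiffBump.dist_normed_convolution_le (φ := ψ) (x₀ := z) (ε := ε / 2)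
      hfi.aestronglyMeasurable (fun a ha => by
        rw [indicator_of_mem (hball z hz (Metric.ball_subset_closedBall ha)),
          indicator_of_mem hzL]
        exact h a ha)
    rw [normed_convolution_indicator hA.measurableSet hLA ψ z (hball z hz) f,
      indicator_of_mem hzL, Real.dist_eq,
      setIntegral_mul_eq_integral_indicator_mul hA.measurableSet hLA] at this
    · exact this
    · exact (subset_tsupport _).trans (isTestFunction_normed_sub ψ z (hball z hz)).1.2.2
  have htest := isTestFunction_normed_sub ψ x (hball x hx)
  set ζ : EuclideanSpace ℝ (Fin n) → ℝ := fun a => ψ.normed volume (x - a) with hζ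
  have hζv : ∀ a, ζ (a - (1 : ℝ) • (y - x)) = ψ.normed volume (y - a) := by
    intro a; simp only [hζ]; congr 1; module
  have key := hG.integral_translate_sub hA hL hLA htest.1.1 htest.1.2.1 (y - x) zero_le_one (by
    intro s hs z hz
    refine hball (x + s • (y - x)) ?_ ?_
    · rw [segment_eq_image']; exact ⟨s, hs, rfl⟩
    · have := htest.2 hz
      rw [Metric.mem_closedBall] at this ⊢
      simpa using this)
  simp_rw [hζv] at key
  have hint : ∀ s : ℝ, Integrable (fun a => M * ‖y - x‖ * ζ (a - s • (y - x))) volume ∧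
      ∫ a, M * ‖y - x‖ * ζ (a - s • (y - x)) = M * ‖y - x‖ := by
    intro s
    have e : ∀ a, ζ (a - s • (y - x)) = ψ.normed volume ((x + s • (y - x)) - a) := by
      intro a; simp only [hζ]; congr 1; module
    simp_rw [e]
    refine ⟨((ψ.integrable_normed (μ := volume)).comp_sub_left _).const_mul _, ?_⟩
    rw [integral_const_mul, integral_sub_left_eq_self (fun z => ψ.normed volume z),
      ψ.integral_normed, mul_one]
  have hbd : ‖∫ s in (0 : ℝ)..1, ∫ a, L.indicator (fun z => inner ℝ (y - x) (G z)) a *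
      ζ (a - s • (y - x))‖ ≤ M * ‖y - x‖ * |1 - 0| := by
    refine intervalIntegral.norm_integral_le_of_norm_le_const fun s _ => ?_
    rw [← (hint s).2]
    refine norm_integral_le_of_norm_le (hint s).1 ?_
    filter_upwards [(ae_restrict_iff' hA.measurableSet).1 hM] with a ha
    have h0 : 0 ≤ ζ (a - s • (y - x)) := ψ.nonneg_normed _
    rw [norm_mul, Real.norm_of_nonneg h0]
    by_cases haL : a ∈ L
    · rw [indicator_of_mem haL]
      gcongr
      refine (norm_inner_le_norm _ _).trans ?_
      rw [mul_comm]
      gcongr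
      exact ha (hLA haL)
    · rw [indicator_of_notMem haL, norm_zero, zero_mul]
      -- `M` is nonnegative because `A`, open and nonempty, is not a null set.
      have hM0 : 0 ≤ M * ‖y - x‖ * ζ (a - s • (y - x)) := by
        by_cases hz : ζ (a - s • (y - x)) = 0
        · rw [hz, mul_zero]
        · have hM0 : 0 ≤ M := by
            by_contra hneg
            have : volume A = 0 := by
              rw [← Measure.restrict_apply_univ]
              refine measure_mono_null ?_ (ae_iff.1 hM)
              intro b _ hb
              exact hneg ((norm_nonneg _).trans hb)
            exact (hA.measure_pos volume ⟨x, hseg hx⟩).ne' this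
          positivity
      exact hM0
  rw [← key] at hbd
  have h1 := abs_le.1 (happ x hx hrx)
  have h2 := abs_le.1 (happ y hy hry)
  rw [Real.norm_eq_abs, sub_zero, abs_one, mul_one] at hbd
  have h3 := abs_le.1 hbd
  rw [abs_le]
  constructor <;> linarith [h1.1, h1.2, h2.1, h2.2, h3.1, h3.2]

theorem eventually_abs_sub_le_of_lipSeminorm_lt {A : Set (EuclideanSpace ℝ (Fin n))}
    (hA : IsOpen A) {f : EuclideanSpace ℝ (Fin n) → ℝ} {K : ℝ≥0} (hK : lipSeminorm A f < K)
    {x : EuclideanSpace ℝ (Fin n)} (hx : x ∈ A) :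
    ∀ᶠ y in 𝓝 x, |f y - f x| ≤ K * ‖y - x‖ := by
  have h1 : limsup (fun y => edist (f x) (f y) / edist x y) (𝓝[A \ {x}] x) < K :=
    lt_of_le_of_lt (le_iSup₂ (f := fun x (_ : x ∈ A) =>
      limsup (fun y => edist (f x) (f y) / edist x y) (𝓝[A \ {x}] x)) x hx) hK
  have h2 := eventually_lt_of_limsup_lt h1
  rw [eventually_nhdsWithin_iff] at h2
  filter_upwards [h2, hA.mem_nhds hx] with y hy hyA
  by_cases hxy : y = x
  · simp [hxy]
  have h3 := (hy ⟨hyA, hxy⟩).le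
  rw [ENNReal.div_le_iff (by simpa [eq_comm] using hxy) (edist_ne_top _ _)] at h3
  have h4 : nndist (f x) (f y) ≤ K * nndist x y := by
    rw [edist_nndist, edist_nndist] at h3
    exact_mod_cast h3
  have h5 : dist (f x) (f y) ≤ K * dist x y := by exact_mod_cast h4
  rwa [dist_comm, dist_comm x, Real.dist_eq, dist_eq_norm] at h5

theorem continuousOn_of_lipSeminorm_lt_top {A : Set (EuclideanSpace ℝ (Fin n))}
    (hA : IsOpen A) {f : EuclideanSpace ℝ (Fin n) → ℝ} (hf : lipSeminorm A f < ⊤) :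
    ContinuousOn f A := by
  obtain ⟨K, hK, -⟩ := ENNReal.lt_iff_exists_nnreal_btwn.1 hf
  intro x hx
  refine ContinuousAt.continuousWithinAt ?_
  rw [ContinuousAt, tendsto_iff_norm_sub_tendsto_zero]
  refine squeeze_zero' (Eventually.of_forall fun _ => norm_nonneg _)
    (eventually_abs_sub_le_of_lipSeminorm_lt hA hK hx) ?_
  have : Tendsto (fun y => (K : ℝ) * ‖y - x‖) (𝓝 x) (𝓝 (K * ‖x - x‖)) :=
    Continuous.tendsto (by fun_prop) x
  simpa using this

/-- A pointwise bound of the local Lipschitz constant integrates along segments, by the fencing form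
of the mean value inequality. -/
theorem abs_sub_le_of_lipSeminorm_lt {A : Set (EuclideanSpace ℝ (Fin n))}
    (hA : IsOpen A) {f : EuclideanSpace ℝ (Fin n) → ℝ} {K : ℝ≥0} (hK : lipSeminorm A f < K)
    {x y : EuclideanSpace ℝ (Fin n)} (hseg : segment ℝ x y ⊆ A) :
    |f y - f x| ≤ K * ‖y - x‖ := by
  refine le_of_forall_pos_le_add fun ε hε => ?_
  have hline : ∀ s ∈ Icc (0 : ℝ) 1, x + s • (y - x) ∈ A := fun s hs =>
    hseg (by rw [segment_eq_image']; exact ⟨s, hs, rfl⟩)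
  have hcl : Continuous fun s : ℝ => x + s • (y - x) := by fun_prop
  have key := image_norm_le_of_liminf_right_slope_norm_lt_deriv_boundary
    (f := fun s : ℝ => f (x + s • (y - x)) - f x) (f' := fun _ => K * ‖y - x‖)
    (a := 0) (b := 1) (B := fun s => (K * ‖y - x‖ + ε) * s) (B' := fun _ => K * ‖y - x‖ + ε)
    (((continuousOn_of_lipSeminorm_lt_top hA (hK.trans ENNReal.coe_lt_top)).comp
      hcl.continuousOn hline).sub continuousOn_const)
    ?_ (by simp) (by fun_prop) ?_ (fun _ _ _ => by linarith) (right_mem_Icc.2 zero_le_one)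
  · simpa using key
  · intro s hs r hr
    refine Eventually.frequently ?_
    have h1 := (hcl.tendsto s).eventually
      (eventually_abs_sub_le_of_lipSeminorm_lt hA hK (hline s ⟨hs.1, hs.2.le⟩))
    filter_upwards [mem_nhdsWithin_of_mem_nhds h1, self_mem_nhdsWithin] with z hz hzs
    have hzs' : 0 < z - s := sub_pos.2 hzs
    refine lt_of_le_of_lt ?_ hr
    rw [slope_def_field, div_le_iff₀ hzs']
    have e : x + z • (y - x) - (x + s • (y - x)) = (z - s) • (y - x) := by module
    rw [e, norm_smul, Real.norm_of_nonneg hzs'.le] at hz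
    refine (norm_sub_norm_le _ _).trans ?_
    simp only [sub_sub_sub_cancel_right]
    rw [Real.norm_eq_abs]
    linarith
  · intro s _
    simpa using ((hasDerivAt_id s).const_mul (K * ‖y - x‖ + ε)).hasDerivWithinAt

/-! ### Difference quotients of weakly differentiable functions -/

/-- Almost everywhere `|w(x + t v) - w(x)| ≤ ∫₀ᵗ |⟨v, ∇w(x + s v)⟩| ds`. The function `γ` is a Borel
representative of `|⟨v, ∇w⟩|` cut off outside `L`; it makes the right side a measurable function of
`x`. -/
theorem HasWeakGradient.ae_enorm_translate_sub_le {U L V : Set (EuclideanSpace ℝ (Fin n))}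
    (hU : IsOpen U) (hL : IsCompact L) (hLU : L ⊆ U) (hV : IsOpen V)
    {w : EuclideanSpace ℝ (Fin n) → ℝ} {g : EuclideanSpace ℝ (Fin n) → EuclideanSpace ℝ (Fin n)}
    (hw : HasWeakGradient U w g) (v : EuclideanSpace ℝ (Fin n)) {t : ℝ} (ht : 0 ≤ t)
    (hs : ∀ s ∈ Icc 0 t, ∀ x ∈ V, x + s • v ∈ L)
    {γ : EuclideanSpace ℝ (Fin n) → ℝ≥0∞} (hγ : Measurable γ)
    (hγg : γ =ᵐ[volume] fun x => ‖L.indicator (fun x => inner ℝ v (g x)) x‖ₑ) :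
    ∀ᵐ x ∂(volume.restrict V),
      ‖w (x + t • v) - w x‖ₑ ≤ ∫⁻ s in Ioc (0 : ℝ) t, γ (x + s • v) := by
  have hwi : Integrable (L.indicator w) volume := (integrable_indicator_iff hL.measurableSet).2
    (hw.locallyIntegrableOn.integrableOn_compact_subset hLU hL)
  have hgi : Integrable (L.indicator (fun x => inner ℝ v (g x))) volume :=
    (integrable_indicator_iff hL.measurableSet).2
      ((innerSL ℝ v).integrable_comp
        (hw.locallyIntegrableOn_grad.integrableOn_compact_subset hLU hL))
  set a : EuclideanSpace ℝ (Fin n) → ℝ≥0∞ := fun x => ∫⁻ s in Ioc (0 : ℝ) t, γ (x + s • v)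
    with ha
  have ham : Measurable a := by
    refine Measurable.lintegral_prod_right' (f := fun p : EuclideanSpace ℝ (Fin n) × ℝ =>
      γ (p.1 + p.2 • v)) (hγ.comp (by fun_prop))
  have hat : ∫⁻ x, a x ≠ ⊤ := by
    have h1 := lintegral_translate_swap hγ (measurable_const (a := (1 : ℝ≥0∞))) v t
    simp only [mul_one] at h1
    rw [← h1, lintegral_congr_ae hγg]
    simp only [lintegral_const, Measure.restrict_apply MeasurableSet.univ, univ_inter]
    exact ENNReal.mul_ne_top hgi.2.ne (by simp)
  have hafin : ∀ᵐ x ∂volume, a x < ⊤ := ae_lt_top ham hat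
  have hai : Integrable (fun x => (a x).toReal) volume :=
    integrable_toReal_of_lintegral_ne_top ham.aemeasurable hat
  -- The pointwise bound follows by duality from the bound tested against `η`.
  have hshift : Integrable (fun x => L.indicator w (x + t • v)) volume :=
    hwi.comp_add_right (t • v)
  have hbd := ae_abs_le_of_abs_integral_mul_test_le hV
    ((hshift.sub hwi).locallyIntegrable.locallyIntegrableOn V)
    (hai.locallyIntegrable.locallyIntegrableOn V) (by
    intro η hη
    have hsupp : ∀ x, x ∉ V → η x = 0 := fun x hx => by
      by_contra h0
      exact hx (hη.2.2 (subset_tsupport _ h0))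
    rw [setIntegral_eq_integral_of_forall_compl_eq_zero (fun x hx => by rw [hsupp x hx, mul_zero]),
      setIntegral_eq_integral_of_forall_compl_eq_zero
        (fun x hx => by rw [hsupp x hx, abs_zero, mul_zero])]
    have hmulη : ∀ F : EuclideanSpace ℝ (Fin n) → ℝ, Integrable F volume →
        Integrable (fun x => F x * η x) volume := fun F hF =>
      integrable_mul_of_tsupport_subset (U := univ) hη.1.continuous hη.2.1 (subset_univ _)
        (hF.locallyIntegrable.locallyIntegrableOn univ)
    have e1 : ∫ x, ((fun x => L.indicator w (x + t • v)) - L.indicator w) x * η x =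
        (∫ y, L.indicator w y * η (y - t • v)) - ∫ y, L.indicator w y * η y := by
      simp only [Pi.sub_apply, sub_mul]
      rw [integral_sub (hmulη _ hshift) (hmulη _ hwi),
        ← integral_add_right_eq_self (fun y => L.indicator w y * η (y - t • v)) (t • v)]
      simp
    rw [e1, hw.integral_translate_sub hU hL hLU hη.1 hη.2.1 v ht
      (fun s hs' x hx => hs s hs' x (hη.2.2 hx))]
    have hpos : 0 ≤ ∫ x, (a x).toReal * |η x| :=
      integral_nonneg fun x => by positivity
    rw [← Real.norm_eq_abs, ← ENNReal.ofReal_le_ofReal_iff hpos, ofReal_norm,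
      intervalIntegral.integral_of_le ht]
    have hint : Integrable (fun x => (a x).toReal * |η x|) volume := by
      refine (hmulη _ hai).norm.congr (Eventually.of_forall fun x => ?_)
      simp
    rw [ofReal_integral_eq_lintegral_ofReal hint
      (Eventually.of_forall fun x => by positivity)]
    calc ‖∫ s in Ioc 0 t, ∫ y, L.indicator (fun x => inner ℝ v (g x)) y * η (y - s • v)‖ₑ
        ≤ ∫⁻ s in Ioc 0 t, ‖∫ y, L.indicator (fun x => inner ℝ v (g x)) y * η (y - s • v)‖ₑ :=
          enorm_integral_le_lintegral_enorm _
      _ ≤ ∫⁻ s in Ioc 0 t, ∫⁻ y, γ y * ‖η (y - s • v)‖ₑ := by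
          refine lintegral_mono fun s => ?_
          refine (enorm_integral_le_lintegral_enorm _).trans (le_of_eq ?_)
          refine lintegral_congr_ae ?_
          filter_upwards [hγg] with y hy
          rw [hy, enorm_mul]
      _ = ∫⁻ x, a x * ‖η x‖ₑ :=
          lintegral_translate_swap hγ hη.1.continuous.enorm.measurable v t
      _ = ∫⁻ x, ENNReal.ofReal ((a x).toReal * |η x|) := by
          refine lintegral_congr_ae ?_
          filter_upwards [hafin] with x hx
          rw [ENNReal.ofReal_mul ENNReal.toReal_nonneg, ENNReal.ofReal_toReal hx.ne,
            ← Real.norm_eq_abs, ofReal_norm])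
  filter_upwards [hbd, ae_restrict_of_ae hafin, ae_restrict_mem hV.measurableSet] with x hx hxa hxV
  have h1 : x + t • v ∈ L := hs t ⟨ht, le_rfl⟩ x hxV
  have h2 : x ∈ L := by simpa using hs 0 ⟨le_rfl, ht⟩ x hxV
  simp only [Pi.sub_apply] at hx
  rw [indicator_of_mem h1, indicator_of_mem h2, ← Real.norm_eq_abs] at hx
  change _ ≤ a x
  rw [← ofReal_norm, ← ENNReal.ofReal_toReal hxa.ne]
  exact ENNReal.ofReal_le_ofReal hx

/-- A compact subset `K` of an open set `U` has a neighbourhood `V` whose small translates in the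
direction `v` all stay in one compact subset `L` of `U`. -/
theorem exists_translate_thickening {U K : Set (EuclideanSpace ℝ (Fin n))} (hU : IsOpen U)
    (hK : IsCompact K) (hKU : K ⊆ U) (v : EuclideanSpace ℝ (Fin n)) :
    ∃ L V : Set (EuclideanSpace ℝ (Fin n)), ∃ t₀ : ℝ, 0 < t₀ ∧ IsCompact L ∧ L ⊆ U ∧ IsOpen V ∧
      K ⊆ V ∧ ∀ s ∈ Icc 0 t₀, ∀ x ∈ V, x + s • v ∈ L := by
  obtain ⟨δ, hδ, h⟩ := hK.exists_cthickening_subset_open hU hKU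
  refine ⟨Metric.cthickening δ K, Metric.thickening (δ / 2) K, δ / 2 / (‖v‖ + 1), by positivity,
    hK.cthickening, h, Metric.isOpen_thickening, Metric.self_subset_thickening (by positivity) K,
    ?_⟩
  intro s hs x hx
  obtain ⟨z, hz, hxz⟩ := Metric.mem_thickening_iff.1 hx
  refine Metric.mem_cthickening_of_dist_le _ z δ K hz ?_
  have h1 : ‖s • v‖ ≤ δ / 2 := by
    rw [norm_smul, Real.norm_of_nonneg hs.1]
    have := (le_div_iff₀ (by positivity : 0 < ‖v‖ + 1)).1 hs.2
    nlinarith [norm_nonneg v, hs.1]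
  calc dist (x + s • v) z ≤ dist (x + s • v) x + dist x z := dist_triangle _ _ _
    _ ≤ δ / 2 + δ / 2 := by
        gcongr
        · simpa using h1
    _ = δ := by ring

/-- The integrated difference quotient of `w` against `|η|` is at most `∫ |⟨v, ∇w⟩| |η|` up to an
error of order `t`, which comes from the Lipschitz continuity of `η`. -/
theorem HasWeakGradient.exists_lintegral_translate_sub_le {U : Set (EuclideanSpace ℝ (Fin n))}
    (hU : IsOpen U) {w : EuclideanSpace ℝ (Fin n) → ℝ}
    {g : EuclideanSpace ℝ (Fin n) → EuclideanSpace ℝ (Fin n)}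
    (hw : HasWeakGradient U w g) {η : EuclideanSpace ℝ (Fin n) → ℝ} (hη : IsTestFunction U η)
    (v : EuclideanSpace ℝ (Fin n)) :
    ∃ B : ℝ, 0 ≤ B ∧ ∀ᶠ t in 𝓝[>] (0 : ℝ),
      AEMeasurable (fun x => ‖w (x + t • v) - w x‖ₑ * ‖η x‖ₑ) volume ∧
      ∫⁻ x, ‖w (x + t • v) - w x‖ₑ * ‖η x‖ₑ ≤
        ENNReal.ofReal (t * ((∫ x in U, |inner ℝ v (g x)| * |η x|) + B * t)) := by
  obtain ⟨L, V, t₀, ht₀, hL, hLU, hV, hKV, hs⟩ := exists_translate_thickening hU hη.2.1 hη.2.2 v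
  have hwi : Integrable (L.indicator w) volume := (integrable_indicator_iff hL.measurableSet).2
    (hw.locallyIntegrableOn.integrableOn_compact_subset hLU hL)
  have hgi : Integrable (L.indicator (fun x => inner ℝ v (g x))) volume :=
    (integrable_indicator_iff hL.measurableSet).2
      ((innerSL ℝ v).integrable_comp
        (hw.locallyIntegrableOn_grad.integrableOn_compact_subset hLU hL))
  have hsupp : ∀ x, x ∉ V → η x = 0 := fun x hx =>
    image_eq_zero_of_notMem_tsupport fun h => hx (hKV h)
  have hVL : V ⊆ L := fun x hx => by simpa using hs 0 ⟨le_rfl, ht₀.le⟩ x hx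
  obtain ⟨C, hC⟩ := hη.1.lipschitzWith_of_hasCompactSupport hη.2.1 (by simp)
  set I : EuclideanSpace ℝ (Fin n) → ℝ := L.indicator (fun x => inner ℝ v (g x)) with hI
  have hηi : Integrable (fun x => |I x| * |η x|) volume := by
    refine (integrable_mul_of_tsupport_subset (U := univ) hη.1.continuous hη.2.1 (subset_univ _)
        (hgi.locallyIntegrable.locallyIntegrableOn univ)).norm.congr
        (Eventually.of_forall fun x => ?_)
    simp
  have hA : ∫ x in U, |inner ℝ v (g x)| * |η x| = ∫ x, |I x| * |η x| := by
    rw [← integral_indicator hU.measurableSet]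
    congr 1 with x
    by_cases hx : x ∈ V
    · rw [indicator_of_mem (hLU (hVL hx)), hI, indicator_of_mem (hVL hx)]
    · simp [indicator, hsupp x hx]
  have hB0 : 0 ≤ C * ‖v‖ * ∫ x, |I x| :=
    mul_nonneg (by positivity) (integral_nonneg fun x => abs_nonneg _)
  refine ⟨C * ‖v‖ * ∫ x, |I x|, hB0, ?_⟩
  rw [hA]
  filter_upwards [Ioc_mem_nhdsGT ht₀] with t ht
  have hcongr : ∀ x, ‖w (x + t • v) - w x‖ₑ * ‖η x‖ₑ =
      ‖L.indicator w (x + t • v) - L.indicator w x‖ₑ * ‖η x‖ₑ := by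
    intro x
    by_cases hx : x ∈ V
    · rw [indicator_of_mem (hVL hx), indicator_of_mem (hs t ⟨ht.1.le, ht.2⟩ x hx)]
    · simp [hsupp x hx]
  constructor
  · simp_rw [hcongr]
    exact ((hwi.comp_add_right (t • v)).sub hwi).aestronglyMeasurable.enorm.mul
      hη.1.continuous.enorm.measurable.aemeasurable
  obtain ⟨γ, hγ, hγg⟩ := hgi.aestronglyMeasurable.enorm
  have hle := hw.ae_enorm_translate_sub_le hU hL hLU hV v ht.1.le
    (fun s hs' x hx => hs s ⟨hs'.1, hs'.2.trans ht.2⟩ x hx) hγ hγg.symm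
  rw [ae_restrict_iff' hV.measurableSet] at hle
  calc ∫⁻ x, ‖w (x + t • v) - w x‖ₑ * ‖η x‖ₑ
      ≤ ∫⁻ x, (∫⁻ s in Ioc (0 : ℝ) t, γ (x + s • v)) * ‖η x‖ₑ := by
        refine lintegral_mono_ae ?_
        filter_upwards [hle] with x hx
        by_cases hxV : x ∈ V
        · gcongr
          exact hx hxV
        · simp [hsupp x hxV]
    _ = ∫⁻ s in Ioc (0 : ℝ) t, ∫⁻ y, γ y * ‖η (y - s • v)‖ₑ :=
        (lintegral_translate_swap hγ hη.1.continuous.enorm.measurable v t).symm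
    _ ≤ ∫⁻ s in Ioc (0 : ℝ) t,
          ENNReal.ofReal ((∫ x, |I x| * |η x|) + (C * ‖v‖ * ∫ x, |I x|) * t) := by
        refine setLIntegral_mono measurable_const fun s hs' => ?_
        have e : (∫ x, |I x| * |η x|) + (C * ‖v‖ * ∫ x, |I x|) * t =
            ∫ x, |I x| * (|η x| + C * ‖v‖ * t) := by
          simp_rw [mul_add]
          rw [integral_add hηi (hgi.abs.mul_const _), integral_mul_const]
          ring
        rw [e, ofReal_integral_eq_lintegral_ofReal]
        · refine lintegral_mono_ae ?_
          filter_upwards [hγg] with y hy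
          rw [← hy, ENNReal.ofReal_mul (abs_nonneg _), ← Real.norm_eq_abs, ofReal_norm,
            ← ofReal_norm (η _)]
          gcongr
          have h1 := hC.dist_le_mul (y - s • v) y
          rw [Real.dist_eq, dist_eq_norm, sub_sub_cancel_left, norm_neg, norm_smul,
            Real.norm_of_nonneg hs'.1.le] at h1
          have h2 : (C : ℝ) * (s * ‖v‖) ≤ C * ‖v‖ * t := by
            rw [mul_assoc, mul_comm s]
            gcongr
            exact hs'.2
          rw [Real.norm_eq_abs]
          have h3 := abs_sub_abs_le_abs_sub (η (y - s • v)) (η y)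
          linarith
        · simp_rw [mul_add]
          exact hηi.add (hgi.abs.mul_const _)
        · refine Eventually.of_forall fun x => ?_
          have := ht.1
          positivity
    _ = ENNReal.ofReal (t * ((∫ x, |I x| * |η x|) + (C * ‖v‖ * ∫ x, |I x|) * t)) := by
        rw [lintegral_const, Measure.restrict_apply MeasurableSet.univ, univ_inter,
          Real.volume_Ioc, sub_zero, ENNReal.ofReal_mul ht.1.le, mul_comm]

/-! ### Testing the composition -/

theorem norm_le_sum_abs_apply (z : EuclideanSpace ℝ (Fin n)) : ‖z‖ ≤ ∑ j, |z j| := by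
  have hz : z = ∑ i, z i • EuclideanSpace.single i (1 : ℝ) := by
    simpa using ((EuclideanSpace.basisFun (Fin n) ℝ).sum_repr z).symm
  conv_lhs => rw [hz]
  refine (norm_sum_le _ _).trans (le_of_eq ?_)
  simp [norm_smul]

theorem abs_apply_le_norm (z : EuclideanSpace ℝ (Fin n)) (i : Fin n) : |z i| ≤ ‖z‖ :=
  PiLp.norm_apply_le z i

theorem HasWeakGradient.mono {U D : Set (EuclideanSpace ℝ (Fin n))} (hU : MeasurableSet U)
    (hD : MeasurableSet D) (hUD : U ⊆ D) {w : EuclideanSpace ℝ (Fin n) → ℝ}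
    {g : EuclideanSpace ℝ (Fin n) → EuclideanSpace ℝ (Fin n)} (hw : HasWeakGradient D w g) :
    HasWeakGradient U w g := by
  refine ⟨hw.1.mono_set hUD, hw.2.mono_set hUD, fun η hη i => ?_⟩
  have hηD : IsTestFunction D η := ⟨hη.1, hη.2.1, hη.2.2.trans hUD⟩
  have h := hw.integral_eq η hηD i
  rw [setIntegral_mul_eq_integral_indicator_mul hD hUD _ ((subset_tsupport _).trans hη.2.2),
    setIntegral_mul_eq_integral_indicator_mul hD hUD _
      ((subset_tsupport _).trans ((tsupport_fderiv_apply_subset ℝ _).trans hη.2.2))] at h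
  rw [setIntegral_mul_eq_integral_indicator_mul hU subset_rfl _
      ((subset_tsupport _).trans hη.2.2),
    setIntegral_mul_eq_integral_indicator_mul hU subset_rfl _
      ((subset_tsupport _).trans ((tsupport_fderiv_apply_subset ℝ _).trans hη.2.2))]
  exact h

theorem eventually_segment_translate_subset {U A K : Set (EuclideanSpace ℝ (Fin n))}
    (hU : IsOpen U) (hA : IsOpen A) {φ : EuclideanSpace ℝ (Fin n) → EuclideanSpace ℝ (Fin n)}
    (hφ : ContinuousOn φ U) (hmaps : MapsTo φ U A) (hK : IsCompact K) (hKU : K ⊆ U)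
    (v : EuclideanSpace ℝ (Fin n)) :
    ∀ᶠ t in 𝓝[>] (0 : ℝ), ∀ x ∈ K, segment ℝ (φ x) (φ (x + t • v)) ⊆ A := by
  obtain ⟨L, V, t₀, ht₀, hL, hLU, -, hKV, hs⟩ := exists_translate_thickening hU hK hKU v
  obtain ⟨δ, hδ, hδA⟩ := (hK.image_of_continuousOn (hφ.mono hKU)).exists_cthickening_subset_open hA
    (by rintro _ ⟨x, hx, rfl⟩; exact hmaps (hKU hx))
  obtain ⟨r, hr, hunif⟩ := Metric.uniformContinuousOn_iff.1
    (hL.uniformContinuousOn_of_continuous (hφ.mono hLU)) δ hδ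
  have hsmall : ∀ᶠ t in 𝓝[>] (0 : ℝ), ‖t • v‖ < r := by
    have : Tendsto (fun t : ℝ => ‖t • v‖) (𝓝 0) (𝓝 ‖(0 : ℝ) • v‖) :=
      Continuous.tendsto (by fun_prop) 0
    rw [zero_smul, norm_zero] at this
    exact mem_nhdsWithin_of_mem_nhds (this.eventually (gt_mem_nhds hr))
  filter_upwards [hsmall, Ioc_mem_nhdsGT ht₀] with t ht ht' x hx
  have h1 : dist (φ (x + t • v)) (φ x) < δ := by
    refine hunif _ (hs t ⟨ht'.1.le, ht'.2⟩ x (hKV hx)) _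
      (by simpa using hs 0 ⟨le_rfl, ht₀.le⟩ x (hKV hx)) ?_
    simpa using ht
  refine ((convex_closedBall (φ x) δ).segment_subset (Metric.mem_closedBall_self hδ.le)
    (Metric.mem_closedBall.2 h1.le)).trans ?_
  exact (Metric.closedBall_subset_cthickening (mem_image_of_mem φ hx) δ).trans hδA

/-- The chain rule inequality in weak form, for `f` that is `K`-Lipschitz along the segments in `A`:
`η ↦ ∫ (f ∘ φ) ∂_i η` is dominated by `η ↦ ∫ K (∑ j, |∂_i φ_j|) |η|`. -/
theorem abs_integral_comp_mul_fderiv_le {U A : Set (EuclideanSpace ℝ (Fin n))}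
    (hU : IsOpen U) (hA : IsOpen A) {φ : EuclideanSpace ℝ (Fin n) → EuclideanSpace ℝ (Fin n)}
    (hφ : ContinuousOn φ U) (hmaps : MapsTo φ U A)
    {g : Fin n → EuclideanSpace ℝ (Fin n) → EuclideanSpace ℝ (Fin n)}
    (hg : ∀ j, HasWeakGradient U (fun x => φ x j) (g j))
    {f : EuclideanSpace ℝ (Fin n) → ℝ} {K : ℝ≥0}
    (hK : ∀ x y, segment ℝ x y ⊆ A → |f y - f x| ≤ K * ‖y - x‖)
    (hu : LocallyIntegrableOn (fun x => f (φ x)) U volume)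
    {η : EuclideanSpace ℝ (Fin n) → ℝ} (hη : IsTestFunction U η) (i : Fin n) :
    |∫ x in U, f (φ x) * fderiv ℝ η x (EuclideanSpace.single i 1)| ≤
      ∫ x in U, (K * ∑ j, |g j x i|) * |η x| := by
  set v : EuclideanSpace ℝ (Fin n) := EuclideanSpace.single i 1 with hv
  have hinner : ∀ j x, inner ℝ v (g j x) = g j x i := by
    intro j x; simp [hv, EuclideanSpace.inner_single_left]
  obtain ⟨L, V, t₀, ht₀, hL, hLU, hV, hKV, hs⟩ := exists_translate_thickening hU hη.2.1 hη.2.2 v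
  have hui : Integrable (L.indicator (fun x => f (φ x))) volume :=
    (integrable_indicator_iff hL.measurableSet).2 (hu.integrableOn_compact_subset hLU hL)
  set u₁ := L.indicator (fun x => f (φ x)) with hu₁
  have hVL : V ⊆ L := fun x hx => by simpa using hs 0 ⟨le_rfl, ht₀.le⟩ x hx
  have hD := hasDerivAt_integral_mul_translate hui hη.1 hη.2.1 v 0
  have hint : ∀ j, Integrable (fun x => |g j x i| * |η x|) (volume.restrict U) := fun j => by
    refine (integrable_mul_of_tsupport_subset hη.1.continuous hη.2.1 hη.2.2
        (locallyIntegrableOn_apply (hg j).locallyIntegrableOn_grad i)).integrableOn.norm.congr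
        (Eventually.of_forall fun x => ?_)
    simp
  have e1 : ∫ x in U, f (φ x) * fderiv ℝ η x v = ∫ x, u₁ x * fderiv ℝ η (x - (0 : ℝ) • v) v := by
    simp only [zero_smul, sub_zero]
    exact setIntegral_mul_eq_integral_indicator_mul hU.measurableSet hLU _
      ((subset_tsupport _).trans ((tsupport_fderiv_apply_subset ℝ _).trans (hKV.trans hVL)))
  have e2 : ∫ x in U, (K * ∑ j, |g j x i|) * |η x| =
      K * ∑ j, ∫ x in U, |inner ℝ v (g j x)| * |η x| := by
    simp_rw [hinner, mul_assoc, Finset.sum_mul]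
    rw [integral_const_mul, integral_finsetSum _ (fun j _ => hint j)]
  -- Both sides are limits as `t ↓ 0`: of the slope of `s ↦ ∫ u₁(y) η(y - s v) dy`, and of
  -- its bound.
  rw [e1, e2, ← abs_neg, ← Real.norm_eq_abs]
  choose B hB0 hB using fun j => (hg j).exists_lintegral_translate_sub_le hU hη v
  have hslope := hD.tendsto_slope_zero_right
  have hlim : Tendsto (fun t : ℝ => (K : ℝ) * ∑ j, ((∫ x in U, |inner ℝ v (g j x)| * |η x|) +
      B j * t)) (𝓝[>] 0) (𝓝 (K * ∑ j, ((∫ x in U, |inner ℝ v (g j x)| * |η x|) + B j * 0))) :=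
    (Continuous.tendsto (by fun_prop) (0 : ℝ)).mono_left nhdsWithin_le_nhds
  simp only [mul_zero, add_zero] at hlim
  refine le_of_tendsto_of_tendsto hslope.norm hlim ?_
  filter_upwards [eventually_all.2 hB, Ioc_mem_nhdsGT ht₀,
    eventually_segment_translate_subset hU hA hφ hmaps hη.2.1 hη.2.2 v] with t hBt ht hseg
  have hmulη : ∀ F : EuclideanSpace ℝ (Fin n) → ℝ, Integrable F volume →
      Integrable (fun x => F x * η x) volume := fun F hF =>
    integrable_mul_of_tsupport_subset (U := univ) hη.1.continuous hη.2.1 (subset_univ _)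
      (hF.locallyIntegrable.locallyIntegrableOn univ)
  have e3 : (∫ y, u₁ y * η (y - (0 + t) • v)) - ∫ y, u₁ y * η (y - (0 : ℝ) • v) =
      ∫ x, (u₁ (x + t • v) - u₁ x) * η x := by
    simp only [zero_smul, sub_zero, zero_add, sub_mul]
    rw [integral_sub (hmulη _ (hui.comp_add_right (t • v))) (hmulη _ hui),
      ← integral_add_right_eq_self (fun y => u₁ y * η (y - t • v)) (t • v)]
    simp
  rw [e3, norm_smul, norm_inv, Real.norm_of_nonneg ht.1.le, inv_mul_le_iff₀ ht.1]
  have hnonneg : ∀ j, 0 ≤ (∫ x in U, |inner ℝ v (g j x)| * |η x|) + B j * t := fun j =>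
    add_nonneg (integral_nonneg fun x => by positivity) (mul_nonneg (hB0 j) ht.1.le)
  refine (ENNReal.ofReal_le_ofReal_iff (mul_nonneg ht.1.le (mul_nonneg K.coe_nonneg
    (Finset.sum_nonneg fun j _ => hnonneg j)))).1 ?_
  rw [ofReal_norm]
  calc ‖∫ x, (u₁ (x + t • v) - u₁ x) * η x‖ₑ
      ≤ ∫⁻ x, ‖(u₁ (x + t • v) - u₁ x) * η x‖ₑ := enorm_integral_le_lintegral_enorm _
    _ ≤ ∫⁻ x, K * ∑ j, ‖φ (x + t • v) j - φ x j‖ₑ * ‖η x‖ₑ := by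
        refine lintegral_mono fun x => ?_
        by_cases hx : x ∈ tsupport η
        · rw [enorm_mul, ← Finset.sum_mul, ← mul_assoc]
          gcongr
          rw [hu₁, indicator_of_mem (hVL (hKV hx)),
            indicator_of_mem (hs t ⟨ht.1.le, ht.2⟩ x (hKV hx))]
          have h1 : ‖f (φ (x + t • v)) - f (φ x)‖ ≤
              K * ∑ j, ‖φ (x + t • v) j - φ x j‖ := by
            refine (hK _ _ (hseg x hx)).trans ?_
            gcongr
            exact norm_le_sum_abs_apply _
          rw [← ofReal_norm]
          refine (ENNReal.ofReal_le_ofReal h1).trans (le_of_eq ?_)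
          rw [ENNReal.ofReal_mul K.coe_nonneg,
            ENNReal.ofReal_sum_of_nonneg (fun j _ => norm_nonneg _)]
          simp only [ofReal_norm, ENNReal.ofReal_coe_nnreal]
        · simp [image_eq_zero_of_notMem_tsupport hx]
    _ = K * ∑ j, ∫⁻ x, ‖φ (x + t • v) j - φ x j‖ₑ * ‖η x‖ₑ := by
        rw [lintegral_const_mul' _ _ ENNReal.coe_ne_top,
          lintegral_finsetSum' _ (fun j _ => (hBt j).1)]
    _ ≤ K * ∑ j, ENNReal.ofReal (t * ((∫ x in U, |inner ℝ v (g j x)| * |η x|) + B j * t)) := by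
        gcongr with j
        exact (hBt j).2
    _ = ENNReal.ofReal (t * (K * ∑ j, ((∫ x in U, |inner ℝ v (g j x)| * |η x|) + B j * t))) := by
        rw [← ENNReal.ofReal_sum_of_nonneg (fun j _ => mul_nonneg ht.1.le (hnonneg j)),
          ← Finset.mul_sum, mul_left_comm, ENNReal.ofReal_mul K.coe_nonneg,
          ENNReal.ofReal_coe_nnreal]

/-! ### The weak gradient of the composition -/

theorem locallyIntegrableOn_const_mul_sum_abs {U : Set (EuclideanSpace ℝ (Fin n))}
    {g : Fin n → EuclideanSpace ℝ (Fin n) → EuclideanSpace ℝ (Fin n)} (hU : IsOpen U)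
    (hg : ∀ j, LocallyIntegrableOn (g j) U volume) (K : ℝ) (i : Fin n) :
    LocallyIntegrableOn (fun x => K * ∑ j, |g j x i|) U volume := by
  rw [locallyIntegrableOn_iff hU.isLocallyClosed]
  intro k hk hkc
  refine Integrable.const_mul (integrable_finsetSum _ fun j _ => ?_) K
  exact (LocallyIntegrableOn.integrableOn_compact_subset
    (locallyIntegrableOn_apply (hg j) i) hk hkc).abs

/-- The chain rule inequality, for any weak gradient `H` of `f ∘ φ`. -/
theorem HasWeakGradient.ae_norm_le_of_comp {U A : Set (EuclideanSpace ℝ (Fin n))}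
    (hU : IsOpen U) (hA : IsOpen A) {φ : EuclideanSpace ℝ (Fin n) → EuclideanSpace ℝ (Fin n)}
    (hφ : ContinuousOn φ U) (hmaps : MapsTo φ U A)
    {g : Fin n → EuclideanSpace ℝ (Fin n) → EuclideanSpace ℝ (Fin n)}
    (hg : ∀ j, HasWeakGradient U (fun x => φ x j) (g j))
    {f : EuclideanSpace ℝ (Fin n) → ℝ} {K : ℝ≥0}
    (hK : ∀ x y, segment ℝ x y ⊆ A → |f y - f x| ≤ K * ‖y - x‖)
    {H : EuclideanSpace ℝ (Fin n) → EuclideanSpace ℝ (Fin n)}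
    (hH : HasWeakGradient U (fun x => f (φ x)) H) :
    ∀ᵐ x ∂(volume.restrict U), ‖H x‖ ≤ K * ∑ i, ∑ j, |g j x i| := by
  have h1 : ∀ i, ∀ᵐ x ∂(volume.restrict U), |H x i| ≤ K * ∑ j, |g j x i| := fun i =>
    ae_abs_le_of_abs_integral_mul_test_le hU
      (locallyIntegrableOn_apply hH.locallyIntegrableOn_grad i)
      (locallyIntegrableOn_const_mul_sum_abs hU (fun j => (hg j).locallyIntegrableOn_grad) K i)
      fun η hη => by
        rw [← abs_neg, ← hH.integral_eq η hη i]
        exact abs_integral_comp_mul_fderiv_le hU hA hφ hmaps hg hK hH.locallyIntegrableOn hη i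
  filter_upwards [ae_all_iff.2 h1] with x hx
  rw [Finset.mul_sum]
  exact (norm_le_sum_abs_apply _).trans (Finset.sum_le_sum fun i _ => hx i)

theorem exists_hasWeakGradient_comp {U A : Set (EuclideanSpace ℝ (Fin n))}
    (hU : IsOpen U) (hA : IsOpen A) {φ : EuclideanSpace ℝ (Fin n) → EuclideanSpace ℝ (Fin n)}
    (hφ : ContinuousOn φ U) (hmaps : MapsTo φ U A)
    {g : Fin n → EuclideanSpace ℝ (Fin n) → EuclideanSpace ℝ (Fin n)}
    (hg : ∀ j, HasWeakGradient U (fun x => φ x j) (g j))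
    {p : ℝ} (hp : 1 ≤ p)
    (hgp : ∀ j, MemLp (g j) (ENNReal.ofReal p) (volume.restrict U))
    {f : EuclideanSpace ℝ (Fin n) → ℝ} {K : ℝ≥0}
    (hK : ∀ x y, segment ℝ x y ⊆ A → |f y - f x| ≤ K * ‖y - x‖)
    (hu : LocallyIntegrableOn (fun x => f (φ x)) U volume) :
    ∃ H, HasWeakGradient U (fun x => f (φ x)) H := by
  -- A continuous weight that is integrable on the whole space.
  let ρ : EuclideanSpace ℝ (Fin n) → ℝ := fun x => (1 + ‖x‖) ^ (-((n : ℝ) + 1))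
  have hρ : Continuous ρ := Continuous.rpow_const (by fun_prop) fun x => Or.inl (by positivity)
  have hρ0 : ∀ x, 0 < ρ x := fun x => Real.rpow_pos_of_pos (by positivity) _
  have hρ1 : ∀ x, ρ x ≤ 1 := fun x =>
    Real.rpow_le_one_of_one_le_of_nonpos (by linarith [norm_nonneg x])
      (by have : (0 : ℝ) ≤ n := n.cast_nonneg
          linarith)
  have hρi : Integrable ρ volume := integrable_one_add_norm (by simp)
  -- `a ρ ≤ a ^ p + ρ` for `a ≥ 0`, as `p ≥ 1` and `ρ ≤ 1`: no exponent conjugate to `p` is needed.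
  have hgρ : ∀ i j, Integrable (fun x => |g j x i| * ρ x) (volume.restrict U) := by
    intro i j
    have h1 : Integrable (fun x => ‖g j x‖ ^ p + ρ x) (volume.restrict U) := by
      have := (hgp j).integrable_norm_rpow (by simpa using by linarith) ENNReal.ofReal_ne_top
      rw [ENNReal.toReal_ofReal (by linarith)] at this
      exact this.add hρi.integrableOn
    refine h1.mono' ?_ (Eventually.of_forall fun x => ?_)
    · exact ((EuclideanSpace.proj (𝕜 := ℝ) i).continuous.comp_aestronglyMeasurable
        (hgp j).aestronglyMeasurable).norm.mul hρ.aestronglyMeasurable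
    · rw [Real.norm_of_nonneg (mul_nonneg (abs_nonneg _) (hρ0 x).le)]
      refine (mul_le_mul_of_nonneg_right (abs_apply_le_norm _ i) (hρ0 x).le).trans ?_
      rcases le_total ‖g j x‖ 1 with h | h
      · have := mul_le_mul_of_nonneg_right h (hρ0 x).le
        have := Real.rpow_nonneg (norm_nonneg (g j x)) p
        linarith
      · have h2 := mul_le_mul_of_nonneg_left (hρ1 x) (norm_nonneg (g j x))
        have h3 := Real.rpow_le_rpow_of_exponent_le h hp
        rw [Real.rpow_one] at h3
        linarith [hρ0 x]
  have hfd : ∀ η ∈ testSubmodule U, ∀ i : Fin n, Integrable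
      (fun x => f (φ x) * fderiv ℝ η x (EuclideanSpace.single i 1)) (volume.restrict U) := by
    intro η hη i
    exact (integrable_mul_of_tsupport_subset
      ((hη.1.continuous_fderiv (by simp)).clm_apply continuous_const)
      (hη.2.1.fderiv_apply ℝ _) ((tsupport_fderiv_apply_subset ℝ _).trans hη.2.2) hu).integrableOn
  have hcomp : ∀ i : Fin n, ∃ h : EuclideanSpace ℝ (Fin n) → ℝ, LocallyIntegrableOn h U volume ∧
      ∀ η : EuclideanSpace ℝ (Fin n) → ℝ, IsTestFunction U η →
        ∫ x in U, f (φ x) * fderiv ℝ η x (EuclideanSpace.single i 1) = - ∫ x in U, h x * η x := by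
    intro i
    let T : testSubmodule U →ₗ[ℝ] ℝ :=
      { toFun := fun η => -∫ x in U, f (φ x) * fderiv ℝ η.1 x (EuclideanSpace.single i 1)
        map_add' := by
          intro a b
          rw [← neg_add, ← integral_add (hfd a.1 a.2 i) (hfd b.1 b.2 i)]
          congr 2 with x
          have := fderiv_add (a.2.1.differentiable (by simp) x) (b.2.1.differentiable (by simp) x)
          rw [Submodule.coe_add, this, _root_.add_apply, mul_add]
        map_smul' := by
          intro c a
          rw [RingHom.id_apply, smul_eq_mul, mul_neg, ← integral_const_mul]
          congr 2 with x
          have := fderiv_const_smul (a.2.1.differentiable (by simp) x) c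
          rw [Submodule.coe_smul, this, _root_.smul_apply, smul_eq_mul]
          ring }
    obtain ⟨h, hh, hT⟩ := exists_integral_eq_of_abs_le_integral hU
      (h := fun x => K * ∑ j, |g j x i|)
      (fun x => mul_nonneg K.coe_nonneg (Finset.sum_nonneg fun j _ => abs_nonneg _))
      (locallyIntegrableOn_const_mul_sum_abs hU
        (fun j => (hg j).locallyIntegrableOn_grad) K i).aestronglyMeasurable hρ hρ0
      (by
        simp_rw [mul_assoc, Finset.sum_mul]
        exact (integrable_finsetSum _ fun j _ => hgρ i j).const_mul _) T (by
        intro η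
        change |-∫ x in U, f (φ x) * fderiv ℝ η.1 x (EuclideanSpace.single i 1)| ≤ _
        rw [abs_neg]
        exact abs_integral_comp_mul_fderiv_le hU hA hφ hmaps hg hK hu η.2 i)
    refine ⟨h, hh, fun η hη => ?_⟩
    rw [← hT ⟨η, hη⟩]
    exact (neg_neg _).symm
  choose h hh hint using hcomp
  refine ⟨fun x => WithLp.toLp 2 fun i => h i x, hu, ?_, fun η hη i => hint i η hη⟩
  have e : (fun x => WithLp.toLp 2 fun i => h i x) =
      fun x => ∑ i, h i x • EuclideanSpace.single i (1 : ℝ) := by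
    ext x j
    simp [Pi.single_apply]
  rw [e, locallyIntegrableOn_iff hU.isLocallyClosed]
  intro k hk hkc
  exact integrable_finsetSum _ fun i _ =>
    Integrable.smul_const ((hh i).integrableOn_compact_subset hk hkc) _

/-! ### The set function -/

theorem memLp_sum_sum_abs {U : Set (EuclideanSpace ℝ (Fin n))} {q : ℝ≥0∞}
    {g : Fin n → EuclideanSpace ℝ (Fin n) → EuclideanSpace ℝ (Fin n)}
    (hg : ∀ j, MemLp (g j) q (volume.restrict U)) :
    MemLp (fun x => ∑ i, ∑ j, |g j x i|) q (volume.restrict U) :=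
  memLp_finsetSum _ fun i _ => memLp_finsetSum _ fun j _ =>
    (ContinuousLinearMap.comp_memLp' (EuclideanSpace.proj (𝕜 := ℝ) i) (hg j)).norm

theorem lintegral_enorm_rpow_le_of_ae_norm_le {U : Set (EuclideanSpace ℝ (Fin n))} {p : ℝ}
    (hp : 1 ≤ p) {H : EuclideanSpace ℝ (Fin n) → EuclideanSpace ℝ (Fin n)}
    {S : EuclideanSpace ℝ (Fin n) → ℝ} {K : ℝ≥0}
    (h : ∀ᵐ x ∂(volume.restrict U), ‖H x‖ ≤ K * S x) :
    ∫⁻ x in U, ‖H x‖ₑ ^ p ≤ (K : ℝ≥0∞) ^ p * ∫⁻ x in U, ‖S x‖ₑ ^ p := by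
  have hp0 : 0 ≤ p := by linarith
  rw [← lintegral_const_mul' _ _ (ENNReal.rpow_ne_top_of_nonneg hp0 ENNReal.coe_ne_top)]
  refine lintegral_mono_ae ?_
  filter_upwards [h] with x hx
  rw [← ENNReal.mul_rpow_of_nonneg _ _ hp0]
  gcongr
  rw [← ofReal_norm]
  refine (ENNReal.ofReal_le_ofReal (hx.trans
    (mul_le_mul_of_nonneg_left (Real.le_norm_self _) K.coe_nonneg))).trans (le_of_eq ?_)
  rw [ENNReal.ofReal_mul K.coe_nonneg, ofReal_norm, ENNReal.ofReal_coe_nnreal]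

theorem isCountablyAdditiveSetFunction_measure_preimage
    (ν : Measure (EuclideanSpace ℝ (Fin n))) [IsFiniteMeasure ν]
    (φ : OpenPartialHomeomorph (EuclideanSpace ℝ (Fin n)) (EuclideanSpace ℝ (Fin n))) :
    IsCountablyAdditiveSetFunction φ.target fun A => (ν (φ.source ∩ φ ⁻¹' A)).toNNReal := by
  intro A hA _ hdisj _
  rw [← ENNReal.hasSum_coe]
  simp only [ENNReal.coe_toNNReal (measure_ne_top ν _)]
  rw [preimage_iUnion, inter_iUnion, measure_iUnion
    (fun i j hij => ((hdisj hij).preimage φ).mono inter_subset_right inter_subset_right)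
    (fun i => (φ.isOpen_inter_preimage (hA i)).measurableSet)]
  exact ENNReal.summable.hasSum

end Composition

theorem theorem2 (n : ℕ) (p : ℝ) (hp : 1 ≤ p)
    (D D' : Set (EuclideanSpace ℝ (Fin n)))
    (hD : IsOpen D) (hDc : IsConnected D) (hD' : IsOpen D') (hDc' : IsConnected D')
    (φ : OpenPartialHomeomorph (EuclideanSpace ℝ (Fin n)) (EuclideanSpace ℝ (Fin n)))
    (hsource : φ.source = D) (htarget : φ.target = D')
    (hφ : MapMemL1 p D φ) :
    ∃ Φ : Set (EuclideanSpace ℝ (Fin n)) → ℝ≥0,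
      IsBoundedSetFunction D' Φ ∧ IsMonotoneSetFunction D' Φ ∧
      IsCountablyAdditiveSetFunction D' Φ ∧
      ∀ A' : Set (EuclideanSpace ℝ (Fin n)), IsOpen A' → Bornology.IsBounded A' → A' ⊆ D' →
        ∀ f : EuclideanSpace ℝ (Fin n) → ℝ, MemL1InftyZero A' f →
          MemL1 p (D ∩ φ ⁻¹' A') (fun x => f (φ x)) ∧
          ∀ G H : EuclideanSpace ℝ (Fin n) → EuclideanSpace ℝ (Fin n),
            HasWeakGradient A' f G →
            HasWeakGradient (D ∩ φ ⁻¹' A') (fun x => f (φ x)) H →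
            ∫⁻ x in D ∩ φ ⁻¹' A', ‖H x‖ₑ ^ p ≤
              (Φ A' : ℝ≥0∞) * essSup (fun y => ‖G y‖ₑ ^ p) (volume.restrict A') := by
  subst hsource htarget
  have hp0 : 0 < p := by linarith
  choose g hg hgp using hφ
  set S : EuclideanSpace ℝ (Fin n) → ℝ := fun x => ∑ i, ∑ j, |g j x i| with hS
  have hSp : MemLp S (ENNReal.ofReal p) (volume.restrict φ.source) := memLp_sum_sum_abs hgp
  let ν : Measure (EuclideanSpace ℝ (Fin n)) :=
    (volume.restrict φ.source).withDensity fun x => ‖S x‖ₑ ^ p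
  have hfin : ∫⁻ x in φ.source, ‖S x‖ₑ ^ p < ⊤ := by
    have := lintegral_rpow_enorm_lt_top_of_eLpNorm_lt_top (by simpa using hp0) ENNReal.ofReal_ne_top
      hSp.eLpNorm_lt_top
    rwa [ENNReal.toReal_ofReal hp0.le] at this
  have : IsFiniteMeasure ν := isFiniteMeasure_withDensity hfin.ne
  refine ⟨fun A => (ν (φ.source ∩ φ ⁻¹' A)).toNNReal, ⟨(ν univ).toNNReal, fun A _ _ _ =>
    ENNReal.toNNReal_mono (measure_ne_top ν _) (measure_mono (subset_univ _))⟩,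
    fun A B _ _ _ hAB _ => ENNReal.toNNReal_mono (measure_ne_top ν _)
      (measure_mono (inter_subset_inter_right _ (preimage_mono hAB))),
    isCountablyAdditiveSetFunction_measure_preimage ν φ, ?_⟩
  intro A hA _ _ f hf
  have hU : IsOpen (φ.source ∩ φ ⁻¹' A) := φ.isOpen_inter_preimage hA
  have hν : ν (φ.source ∩ φ ⁻¹' A) = ∫⁻ x in φ.source ∩ φ ⁻¹' A, ‖S x‖ₑ ^ p := by
    rw [withDensity_apply _ hU.measurableSet, Measure.restrict_restrict hU.measurableSet,
      inter_assoc, inter_comm (φ ⁻¹' A), ← inter_assoc, inter_self]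
  simp only [ENNReal.coe_toNNReal (measure_ne_top ν _)]
  rw [hν]
  set U := φ.source ∩ φ ⁻¹' A with hUdef
  have hUD : U ⊆ φ.source := inter_subset_left
  have hφc : ContinuousOn φ U := φ.continuousOn.mono hUD
  have hmaps : MapsTo φ U A := fun x hx => hx.2
  have hgU : ∀ j, HasWeakGradient U (fun x => φ x j) (g j) := fun j =>
    (hg j).mono hU.measurableSet φ.open_source.measurableSet hUD
  have hgpU : ∀ j, MemLp (g j) (ENNReal.ofReal p) (volume.restrict U) := fun j =>
    (hgp j).mono_measure (Measure.restrict_mono hUD le_rfl)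
  have hfc : ContinuousOn f A := continuousOn_of_lipSeminorm_lt_top hA hf.1.2
  obtain ⟨K, hK, -⟩ := ENNReal.lt_iff_exists_nnreal_btwn.1 hf.1.2
  have hKlip : ∀ x y, segment ℝ x y ⊆ A → |f y - f x| ≤ K * ‖y - x‖ := fun x y h =>
    abs_sub_le_of_lipSeminorm_lt hA hK h
  have hu : LocallyIntegrableOn (fun x => f (φ x)) U volume :=
    (hfc.comp hφc hmaps).locallyIntegrableOn hU.measurableSet
  refine ⟨?_, fun G H hG hH => ?_⟩
  · obtain ⟨H, hH⟩ := exists_hasWeakGradient_comp hU hA hφc hmaps hgU hp hgpU hKlip hu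
    refine ⟨H, hH, ((memLp_sum_sum_abs hgpU).const_mul (K : ℝ)).of_le
      hH.locallyIntegrableOn_grad.aestronglyMeasurable ?_⟩
    filter_upwards [hH.ae_norm_le_of_comp hU hA hφc hmaps hgU hKlip] with x hx
    exact hx.trans (Real.le_norm_self _)
  · set m := essSup (fun y => ‖G y‖ₑ ^ p) (volume.restrict A) with hm
    by_cases hmtop : m = ⊤
    · have h1 := lintegral_enorm_rpow_le_of_ae_norm_le hp
        (hH.ae_norm_le_of_comp hU hA hφc hmaps hgU hKlip)
      -- The product `0 * ⊤` is `0`, so here the bound with the finite constant `K` is needed.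
      by_cases hS0 : ∫⁻ x in U, ‖S x‖ₑ ^ p = 0
      · rw [hS0, zero_mul]
        rw [hS0, mul_zero] at h1
        exact h1
      · rw [hmtop, ENNReal.mul_top hS0]
        exact le_top
    · set M : ℝ≥0 := (m ^ p⁻¹).toNNReal with hMdef
      have hM : (M : ℝ≥0∞) = m ^ p⁻¹ :=
        ENNReal.coe_toNNReal (ENNReal.rpow_ne_top_of_nonneg (by positivity) hmtop)
      have hGM : ∀ᵐ x ∂(volume.restrict A), ‖G x‖ ≤ M := by
        filter_upwards [ENNReal.ae_le_essSup (fun y => ‖G y‖ₑ ^ p)] with x hx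
        have h1 : ‖G x‖ₑ ≤ M := by
          rw [hM, ENNReal.le_rpow_inv_iff hp0]
          exact hx
        rw [enorm_eq_nnnorm] at h1
        exact_mod_cast h1
      have h1 := lintegral_enorm_rpow_le_of_ae_norm_le hp
        (hH.ae_norm_le_of_comp hU hA hφc hmaps hgU
          fun x y h => hG.abs_sub_le_of_ae_norm_le hA hfc hGM h)
      rwa [hM, ← ENNReal.rpow_mul, inv_mul_cancel₀ hp0.ne', ENNReal.rpow_one, mul_comm] at h1
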